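/- **Setting.** Let $n\ge 1$, $\nu\in[0,1]$, $M_\nu,\mu,\sigma,\varepsilon>0$, $\beta\in(0,1)$. Let $f:\mathbb R^n\to\mathbb R$ be differentiable and $\mu$-strongly convex, i.e. $f(y)\ge f(x)+\langle\nabla f(x),y-x\rangle+\frac{\mu}{2}\|y-x\|_2^2$ for all $x,y\in\mathbb R^n$, with minimizer $x^*$. Let $R_0\ge\|x^0-x^*\|_2$ and suppose $\|\nabla f(x)-\nabla f(y)\|_2\le M_\nu\|x-y\|_2^\nu$ for all $x,y$ in $B_{3R_0}(x^*)=\{x:\|x-x^*\|_2\le 3R_0\}$. Suppose $2\varepsilon<\mu R_0^2$. At every $x\in\mathbb R^n$ a stochastic gradient $\nabla f(x,\xi)$ is available, with $\mathbb E_\xi[\nabla f(x,\xi)]=\nabla f(x)$ and $\mathbb E_\xi[\|\nabla f(x,\xi)-\nabla f(x)\|_2^2]\le\sigma^2$; one evaluation of $\nabla f(x,\xi)$ is one oracle call. **Method.** clipped-SSTM with starting point $x^0$, $N$ iterations, batchsizes $m_k$, stepsize parameter $\alpha$ and clipping parameter $B$ sets $A_0=0$, $y^0=z^0=x^0$ and,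 for $k=0,\dots,N-1$: $\alpha_{k+1}=\alpha(k+1)^{\frac{2\nu}{1+\nu}}$, $A_{k+1}=A_k+\alpha_{k+1}$, $\lambda_{k+1}=B/\alpha_{k+1}$, $x^{k+1}=(A_ky^k+\alpha_{k+1}z^k)/A_{k+1}$; it draws fresh i.i.d. samples $\xi^k_1,\dots,\xi^k_{m_k}$, forms $g=\frac1{m_k}\sum_i\nabla f(x^{k+1},\xi_i^k)$ and $\tilde g=\min\{1,\lambda_{k+1}/\|g\|_2\}\,g$ (with $\tilde g=0$ if $g=0$), and sets $z^{k+1}=z^k-\alpha_{k+1}\tilde g$, $y^{k+1}=(A_ky^k+\alpha_{k+1}z^{k+1})/A_{k+1}$. Its output is $y^N$. R-clipped-SSTM sets $\hat x^0=x^0$ and, for $t=1,\dots,\tau$, lets $\hat x^t$ be the output of clipped-SSTM started at $\hat x^{t-1}$ with parameters $N_t,(m_k^t)_k,\alpha^t,B_t$. **Parameters.** Let $C=\sqrt7$, $\tau=\lceil\log_2\frac{\mu R_0^2}{2\varepsilon}\rceil$ (so $\tau\ge1$), and for $t=1,\dots,\tau$ let $\varepsilon_t=\frac{\mu R_0^2}{2^{t+1}}$,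 $L_t=\ln\frac{4N_t\tau}{\beta}$, $a_t=16384L_t^2$, and let the positive integers $N_t$ satisfy $$N_t=\left\lceil\frac{2^{\frac{1+\nu}{1+3\nu}}a_t^{\frac{1+\nu}{1+3\nu}}C^{\frac{2(1+\nu)}{1+3\nu}}R_0^{\frac{2(1+\nu)}{1+3\nu}}M_\nu^{\frac{2}{1+3\nu}}}{2^{\frac{(1+\nu)(t-1)}{1+3\nu}}\varepsilon_t^{\frac{2}{1+3\nu}}}\right\rceil+1 .$$ Let $$\alpha^t=\frac{(\varepsilon_t/2)^{\frac{1-\nu}{1+\nu}}}{2^{\frac{2\nu}{1+\nu}}a_tM_\nu^{\frac{2}{1+\nu}}},\quad \alpha^t_{k+1}=\alpha^t(k+1)^{\frac{2\nu}{1+\nu}},\quad B_t=\frac{CR_0}{16\cdot2^{\frac{t-1}{2}}L_t},\quad m_k^t=\left\lceil\max\left\{1,\frac{20736\cdot2^{t-1}N_t\sigma^2(\alpha^t_{k+1})^2L_t}{C^2R_0^2}\right\}\right\rceil,$$ and assume, for $t=1,\dots,\tau$, that $L_t\ge2$ and $$\varepsilon_t^{\frac{1-\nu}{1+\nu}}\le\frac{a_tCM_\nu^{\frac{1-\nu}{1+\nu}}R_0^{1-\nu}}{16\cdot2^{\frac{(1-\nu)(t-1)}{2}}L_t},\qquad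 \varepsilon_t\le\frac{2^{\frac{1+\nu}{2}}a_t^{\frac{1+\nu}{2}}C^{1+\nu}R_0^{1+\nu}M_\nu}{100^{\frac{1+3\nu}{2}}2^{\frac{(1+\nu)(t-1)}{2}}},$$ $$\varepsilon_t^{\frac{1-\nu}{1+3\nu}}\le\min\left\{\frac{a_t^{\frac{2+3\nu-\nu^2}{2(1+3\nu)}}}{2^{2+4\nu+\frac{3+8\nu-5\nu^2-6\nu^3}{(1+\nu)(1+3\nu)}}L_t},\ \frac{a_t^{\frac{(1+\nu)^2}{1+3\nu}}}{2^{4+7\nu+\frac{2+7\nu+2\nu^2-3\nu^3}{(1+\nu)(1+3\nu)}}L_t^{1+\nu}}\right\}\frac{C^{\frac{1-\nu^2}{1+3\nu}}R_0^{\frac{1-\nu^2}{1+3\nu}}M_\nu^{\frac{1-\nu}{1+3\nu}}}{2^{\frac{(1-\nu^2)(t-1)}{2(1+3\nu)}}}.$$ **Claim.** After $\tau$ restarts, R-clipped-SSTM produces $\hat x^\tau$ with $\mathbb P\{f(\hat x^\tau)-f(x^*)\le\varepsilon\}\ge1-\beta$. Moreover, with $$\Lambda=\max\left\{1,\ \ln\frac{M_\nu^{\frac{2}{1+3\nu}}\ln\frac{\mu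 R_0^2}{\varepsilon}}{\mu^{\frac{1+\nu}{1+3\nu}}\varepsilon^{\frac{1-\nu}{1+3\nu}}\beta}\right\},$$ there is a constant $c>0$ depending only on $\nu$ such that the total number $\hat N$ of iterations of clipped-SSTM satisfies $$\hat N\le c\,\max\left\{\left(\frac{M_\nu}{\mu R_0^{1-\nu}}\right)^{\frac{2}{1+3\nu}}\ln\frac{\mu R_0^2}{\varepsilon},\ \left(\frac{M_\nu^2}{\mu^{1+\nu}\varepsilon^{1-\nu}}\right)^{\frac{1}{1+3\nu}}\right\}\Lambda^{\frac{2(1+\nu)}{1+3\nu}}$$ and the total number of oracle calls is at most $c\max\{\hat N,\ \frac{\sigma^2}{\mu\varepsilon}\Lambda\}$. -/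

import Mathlib

open MeasureTheory ProbabilityTheory

namespace ClippedSSTM

noncomputable section

/-! ### Assumptions on the problem -/

/-- A differentiable function `f` on `ℝⁿ` is `μ`-strongly convex if
`f y ≥ f x + ⟪∇f x, y - x⟫ + (μ / 2) ‖y - x‖²` for all `x`, `y`. -/
structure IsStronglyConvex {n : ℕ} (f : EuclideanSpace ℝ (Fin n) → ℝ) (μ : ℝ) : Prop where
  differentiable : Differentiable ℝ f
  lower_bound : ∀ x y : EuclideanSpace ℝ (Fin n),
    f x + inner ℝ (gradient f x) (y - x) + μ / 2 * ‖y - x‖ ^ 2 ≤ f y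

/-- The gradient of `f` is `(ν, M)`-Hölder continuous on `Q`. -/
def HasHolderGradientOn {n : ℕ} (f : EuclideanSpace ℝ (Fin n) → ℝ) (ν M : ℝ)
    (Q : Set (EuclideanSpace ℝ (Fin n))) : Prop :=
  ∀ x ∈ Q, ∀ y ∈ Q, ‖gradient f x - gradient f y‖ ≤ M * ‖x - y‖ ^ ν

/-- `G x ξ`, with `ξ` distributed according to `D`, is an unbiased estimator of `∇f x` with
variance at most `σ²`, at every point `x`. -/
structure IsStochasticGradient {n : ℕ} {Ξ : Type*} [MeasurableSpace Ξ]
    (f : EuclideanSpace ℝ (Fin n) → ℝ)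
    (G : EuclideanSpace ℝ (Fin n) → Ξ → EuclideanSpace ℝ (Fin n))
    (D : Measure Ξ) (σ : ℝ) : Prop where
  measurable : Measurable (Function.uncurry G)
  integrable : ∀ x, Integrable (G x) D
  unbiased : ∀ x, ∫ s, G x s ∂D = gradient f x
  integrable_sq : ∀ x, Integrable (fun s => ‖G x s - gradient f x‖ ^ 2) D
  variance_le : ∀ x, ∫ s, ‖G x s - gradient f x‖ ^ 2 ∂D ≤ σ ^ 2

/-! ### The method clipped-SSTM and its restarted version

The randomness enters through a realization of the samples; the runs below carry counters of the
iterations and of the oracle calls, i.e. of the evaluations of the stochastic gradient `G`. -/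

section Method

variable {E : Type*} [NormedAddCommGroup E] [NormedSpace ℝ E] {Ξ : Type*}

/-- The clipping operator `clip(v, l) = min {1, l / ‖v‖} v` (equal to `0` for `v = 0`). -/
def clip (v : E) (l : ℝ) : E := min 1 (l / ‖v‖) • v

/-- The mini-batched stochastic gradient `(1 / m) ∑_{i < m} G x (s i)`. -/
def miniBatch (G : E → Ξ → E) (m : ℕ) (s : ℕ → Ξ) (x : E) : E :=
  (m : ℝ)⁻¹ • ∑ i ∈ Finset.range m, G x (s i)

/-- The stepsizes `α_0 = 0`, `α_{k+1} = α (k+1)^{2ν/(1+ν)}`. -/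
def stepSize (α ν : ℝ) : ℕ → ℝ
  | 0 => 0
  | k + 1 => α * ((k : ℝ) + 1) ^ (2 * ν / (1 + ν))

/-- `A_0 = 0`, `A_{k+1} = A_k + α_{k+1}`. -/
def stepSum (α ν : ℝ) : ℕ → ℝ
  | 0 => 0
  | k + 1 => stepSum α ν k + stepSize α ν (k + 1)

/-- The state `(y^k, z^k)` of clipped-SSTM, with the counters. -/
structure State (E : Type*) where
  y : E
  z : E
  iterations : ℕ
  oracleCalls : ℕ

/-- Iteration number `k` of clipped-SSTM: `m` is the batchsize and `s` are the samples of this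
iteration. -/
def step (G : E → Ξ → E) (ν α B : ℝ) (k m : ℕ) (s : ℕ → Ξ) (S : State E) : State E :=
  let x : E := (stepSum α ν (k + 1))⁻¹ • (stepSum α ν k • S.y + stepSize α ν (k + 1) • S.z)
  let g : E := clip (miniBatch G m s x) (B / stepSize α ν (k + 1))
  let z' : E := S.z - stepSize α ν (k + 1) • g
  { y := (stepSum α ν (k + 1))⁻¹ • (stepSum α ν k • S.y + stepSize α ν (k + 1) • z')
    z := z'
    iterations := S.iterations + 1
    oracleCalls := S.oracleCalls + m }

/-- The state of clipped-SSTM after a given number of iterations, started at `x0`, with stepsize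
parameter `α`, clipping parameter `B`, batchsizes `m k`, and samples `s k i`. -/
def run (G : E → Ξ → E) (ν : ℝ) (x0 : E) (α B : ℝ) (m : ℕ → ℕ) (s : ℕ → ℕ → Ξ) :
    ℕ → State E
  | 0 => { y := x0, z := x0, iterations := 0, oracleCalls := 0 }
  | k + 1 => step G ν α B k (m k) (s k) (run G ν x0 α B m s k)

/-- The state of R-clipped-SSTM: the current point, and the total counters. -/
structure RestartState (E : Type*) where
  point : E
  iterations : ℕ
  oracleCalls : ℕ

/-- R-clipped-SSTM after a given number of restarts. Restart `t = 1, 2, …` runs clipped-SSTM for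
`N t` iterations from the current point, with stepsize parameter `α t`, clipping parameter `B t`,
batchsizes `m t k`, and samples `s t k i`. -/
def restartedRun (G : E → Ξ → E) (ν : ℝ) (x0 : E) (N : ℕ → ℕ) (α B : ℕ → ℝ)
    (m : ℕ → ℕ → ℕ) (s : ℕ → ℕ → ℕ → Ξ) : ℕ → RestartState E
  | 0 => { point := x0, iterations := 0, oracleCalls := 0 }
  | t + 1 =>
    let S := restartedRun G ν x0 N α B m s t
    let F := run G ν S.point (α (t + 1)) (B (t + 1)) (m (t + 1)) (s (t + 1)) (N (t + 1))
    { point := F.y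
      iterations := S.iterations + F.iterations
      oracleCalls := S.oracleCalls + F.oracleCalls }

end Method

/-! ### The parameters of the restarts

Throughout, `τ` is the number of restarts and `N t` the number of iterations in restart `t`. -/

/-- `C = √7`. -/
def constC : ℝ := Real.sqrt 7

/-- The number of restarts `τ = ⌈log₂ (μ R₀² / (2 ε))⌉`. -/
def numRestarts (μ R₀ ε : ℝ) : ℕ := ⌈Real.logb 2 (μ * R₀ ^ 2 / (2 * ε))⌉₊

/-- The target accuracy `ε_t = μ R₀² / 2^{t+1}` of restart `t`. -/
def accuracy (μ R₀ : ℝ) (t : ℕ) : ℝ := μ * R₀ ^ 2 / 2 ^ (t + 1)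

/-- `ln (4 N_t τ / β)`. -/
def logNt (β : ℝ) (τ : ℕ) (N : ℕ → ℕ) (t : ℕ) : ℝ := Real.log (4 * (N t : ℝ) * (τ : ℝ) / β)

/-- `a_t = 16384 ln² (4 N_t τ / β)`. -/
def paramA (β : ℝ) (τ : ℕ) (N : ℕ → ℕ) (t : ℕ) : ℝ := 16384 * logNt β τ N t ^ 2

/-- The stepsize parameter
`α^t = (ε_t / 2)^{(1-ν)/(1+ν)} / (2^{2ν/(1+ν)} a_t M^{2/(1+ν)})`. -/
def paramAlpha (ν M μ R₀ β : ℝ) (τ : ℕ) (N : ℕ → ℕ) (t : ℕ) : ℝ :=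
  (accuracy μ R₀ t / 2) ^ ((1 - ν) / (1 + ν)) /
    ((2 : ℝ) ^ (2 * ν / (1 + ν)) * paramA β τ N t * M ^ (2 / (1 + ν)))

/-- The clipping parameter `B_t = C R₀ / (16 · 2^{(t-1)/2} ln (4 N_t τ / β))`. -/
def paramB (R₀ β : ℝ) (τ : ℕ) (N : ℕ → ℕ) (t : ℕ) : ℝ :=
  constC * R₀ / (16 * (2 : ℝ) ^ (((t : ℝ) - 1) / 2) * logNt β τ N t)

/-- The batchsize
`m_k^t = ⌈max {1, 20736 · 2^{t-1} N_t σ² (α_{k+1}^t)² ln (4 N_t τ / β) / (C² R₀²)}⌉`. -/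
def batchSize (ν M μ R₀ σ β : ℝ) (τ : ℕ) (N : ℕ → ℕ) (t k : ℕ) : ℕ :=
  ⌈max 1 (20736 * (2 : ℝ) ^ ((t : ℝ) - 1) * (N t : ℝ) * σ ^ 2 *
      stepSize (paramAlpha ν M μ R₀ β τ N t) ν (k + 1) ^ 2 * logNt β τ N t /
        (constC ^ 2 * R₀ ^ 2))⌉₊

/-- The relations between the parameters, for `t = 1, …, τ`. The number of iterations `N t` is
determined implicitly, since `a_t` depends on it. -/
structure Admissible (ν M μ R₀ β : ℝ) (τ : ℕ) (N : ℕ → ℕ) : Prop where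
  iterations_eq : ∀ t ∈ Finset.Icc 1 τ,
    N t = ⌈(2 : ℝ) ^ ((1 + ν) / (1 + 3 * ν)) * paramA β τ N t ^ ((1 + ν) / (1 + 3 * ν)) *
          constC ^ (2 * (1 + ν) / (1 + 3 * ν)) * R₀ ^ (2 * (1 + ν) / (1 + 3 * ν)) *
          M ^ (2 / (1 + 3 * ν)) /
        ((2 : ℝ) ^ ((1 + ν) * ((t : ℝ) - 1) / (1 + 3 * ν)) *
          accuracy μ R₀ t ^ (2 / (1 + 3 * ν)))⌉₊ + 1
  two_le_log : ∀ t ∈ Finset.Icc 1 τ, 2 ≤ logNt β τ N t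
  accuracy_le₁ : ∀ t ∈ Finset.Icc 1 τ,
    accuracy μ R₀ t ^ ((1 - ν) / (1 + ν)) ≤
      paramA β τ N t * constC * M ^ ((1 - ν) / (1 + ν)) * R₀ ^ (1 - ν) /
        (16 * (2 : ℝ) ^ ((1 - ν) * ((t : ℝ) - 1) / 2) * logNt β τ N t)
  accuracy_le₂ : ∀ t ∈ Finset.Icc 1 τ,
    accuracy μ R₀ t ≤
      (2 : ℝ) ^ ((1 + ν) / 2) * paramA β τ N t ^ ((1 + ν) / 2) * constC ^ (1 + ν) *
          R₀ ^ (1 + ν) * M /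
        ((100 : ℝ) ^ ((1 + 3 * ν) / 2) * (2 : ℝ) ^ ((1 + ν) * ((t : ℝ) - 1) / 2))
  accuracy_le₃ : ∀ t ∈ Finset.Icc 1 τ,
    accuracy μ R₀ t ^ ((1 - ν) / (1 + 3 * ν)) ≤
      min
        (paramA β τ N t ^ ((2 + 3 * ν - ν ^ 2) / (2 * (1 + 3 * ν))) /
          ((2 : ℝ) ^ (2 + 4 * ν +
              (3 + 8 * ν - 5 * ν ^ 2 - 6 * ν ^ 3) / ((1 + ν) * (1 + 3 * ν))) *
            logNt β τ N t))
        (paramA β τ N t ^ ((1 + ν) ^ 2 / (1 + 3 * ν)) /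
          ((2 : ℝ) ^ (4 + 7 * ν +
              (2 + 7 * ν + 2 * ν ^ 2 - 3 * ν ^ 3) / ((1 + ν) * (1 + 3 * ν))) *
            logNt β τ N t ^ (1 + ν))) *
      (constC ^ ((1 - ν ^ 2) / (1 + 3 * ν)) * R₀ ^ ((1 - ν ^ 2) / (1 + 3 * ν)) *
          M ^ ((1 - ν) / (1 + 3 * ν)) /
        (2 : ℝ) ^ ((1 - ν ^ 2) * ((t : ℝ) - 1) / (2 * (1 + 3 * ν))))

/-- R-clipped-SSTM with the parameters above and the samples `ξ (t, k, i) ω`, after all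
`τ = numRestarts μ R₀ ε` restarts. -/
def output {n : ℕ} {Ξ Ω : Type*}
    (G : EuclideanSpace ℝ (Fin n) → Ξ → EuclideanSpace ℝ (Fin n))
    (ξ : ℕ × ℕ × ℕ → Ω → Ξ) (x0 : EuclideanSpace ℝ (Fin n)) (ν M μ R₀ σ ε β : ℝ)
    (N : ℕ → ℕ) (ω : Ω) : RestartState (EuclideanSpace ℝ (Fin n)) :=
  restartedRun G ν x0 N
    (paramAlpha ν M μ R₀ β (numRestarts μ R₀ ε) N)
    (paramB R₀ β (numRestarts μ R₀ ε) N)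
    (batchSize ν M μ R₀ σ β (numRestarts μ R₀ ε) N)
    (fun t k i => ξ (t, k, i) ω)
    (numRestarts μ R₀ ε)

/-! ### The quantities in the complexity bounds -/

/-- `max {(M / (μ R₀^{1-ν}))^{2/(1+3ν)} ln (μ R₀² / ε), (M² / (μ^{1+ν} ε^{1-ν}))^{1/(1+3ν)}}`. -/
def complexity (ν M μ R₀ ε : ℝ) : ℝ :=
  max ((M / (μ * R₀ ^ (1 - ν))) ^ (2 / (1 + 3 * ν)) * Real.log (μ * R₀ ^ 2 / ε))
    ((M ^ 2 / (μ ^ (1 + ν) * ε ^ (1 - ν))) ^ (1 / (1 + 3 * ν)))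

/-- `ln (M^{2/(1+3ν)} ln (μ R₀² / ε) / (μ^{(1+ν)/(1+3ν)} ε^{(1-ν)/(1+3ν)} β))`. -/
def logFactor (ν M μ R₀ ε β : ℝ) : ℝ :=
  Real.log (M ^ (2 / (1 + 3 * ν)) * Real.log (μ * R₀ ^ 2 / ε) /
    (μ ^ ((1 + ν) / (1 + 3 * ν)) * ε ^ ((1 - ν) / (1 + 3 * ν)) * β))

end

end ClippedSSTM

/-!
# High-probability complexity of R-clipped-SSTM

**One run.** Write `D = √7 R`, where `R` bounds the initial distance to the minimizer `x*`, and let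
`L` be the logarithm in the parameters. With `Φ_k = ‖z^k - x*‖² + 2 A_k (f y^k - f x*) - A_k ε / 2`,
convexity and the Hölder condition give `Φ_{k+1} ≤ Φ_k + W_k`, where `W_k` collects the noise of
iteration `k` (`RunBounds.potential_step`). The stepsizes are such that, by a weighted
arithmetic-geometric mean inequality, the Hölder continuous gradient acts like a Lipschitz
continuous one up to errors summing to `A_k ε / 2` (`young_of_alpha`). As long as the iterates are
good (`IsGood`: within distance `D` of `x*`, with a small gap), the true gradient is at most half the
clipping level (`RunBounds.mul_norm_gradient_le`). Then clipping, being the projection onto a ball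
that contains the true gradient, does not increase the noise and has a bias quadratic in it, so
`W_k` is bounded by a multiple of `D² / L`, and `exp (4 L W_k / D²)` has conditional expectation at
most `exp (L / (100 N))` (`exp_noise_le`, `RunBounds.lintegral_exp_noiseTerm_le`). Hence the
exponential of `4 L Φ_k / D²`, frozen when the iterates cease to be good, is almost a
supermartingale. Both an exit from the good states and a final gap above `ε` force the potential
above `3.3 R²`, while it starts below `R²`; Markov's inequality bounds the probability of either
by `exp (-L)` (`RunBounds.measure_lt_le`).

**Restarts.** By strong convexity a gap of at most `ε_t` puts the next starting point within
distance `R₀ / 2^{t/2}` of `x*`. The samples of a restart are independent of its starting point, and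
`exp (-L_t) ≤ β / τ`, so the failure probabilities add up to at most `β`
(`measure_restartedRun_le`).

**Complexity.** The number of iterations `N_t` is `L_t^{2(1+ν)/(1+3ν)}` times a quantity that grows
geometrically with ratio `2^{(1-ν)/(1+3ν)}` (`iterationBound_le`); for `ν < 1` the last restart
dominates, for `ν = 1` all restarts count equally (`sum_rate_le`). As `L_t` is logarithmic in `N_t`,
it is of the order of the logarithmic factor of the bound (`Admissible.logNt_le`). The batchsizes of
a restart sum to a multiple of `N_t + σ² L_t / (μ ε_t)` (`sum_batchSize_le`), and the numbers
`1 / ε_t` form a geometric series.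
-/

namespace ClippedSSTM

/-! ### Strongly convex functions with Hölder continuous gradient -/

section Convex

variable {n : ℕ} {f : EuclideanSpace ℝ (Fin n) → ℝ} {μ ν M : ℝ}
  {xs : EuclideanSpace ℝ (Fin n)}

theorem IsStronglyConvex.le_of_gradient (hf : IsStronglyConvex f μ) (hμ : 0 ≤ μ)
    (x y : EuclideanSpace ℝ (Fin n)) : f x + inner ℝ (gradient f x) (y - x) ≤ f y := by
  have h := hf.lower_bound x y
  have : 0 ≤ μ / 2 * ‖y - x‖ ^ 2 := by positivity
  linarith

theorem gradient_eq_zero_of_forall_le (hmin : ∀ x, f xs ≤ f x) : gradient f xs = 0 := by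
  have h : IsLocalMin f xs := Filter.Eventually.of_forall hmin
  simp [gradient, h.fderiv_eq_zero]

theorem IsStronglyConvex.sq_dist_le (hf : IsStronglyConvex f μ) (hmin : ∀ x, f xs ≤ f x)
    (x : EuclideanSpace ℝ (Fin n)) : μ / 2 * ‖x - xs‖ ^ 2 ≤ f x - f xs := by
  have h := hf.lower_bound xs x
  rw [gradient_eq_zero_of_forall_le hmin, inner_zero_left] at h
  linarith

/-- The descent inequality. Convexity at `y` replaces the integration of the gradient along the
segment, at the price of a factor `1 + ν`. -/
theorem IsStronglyConvex.le_add_holder (hf : IsStronglyConvex f μ) (hμ : 0 ≤ μ)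
    {Q : Set (EuclideanSpace ℝ (Fin n))} (hQ : HasHolderGradientOn f ν M Q)
    {x y : EuclideanSpace ℝ (Fin n)} (hx : x ∈ Q) (hy : y ∈ Q) :
    f y ≤ f x + inner ℝ (gradient f x) (y - x) + M * (‖y - x‖ ^ ν * ‖y - x‖) := by
  have h := hf.le_of_gradient hμ y x
  have h1 : inner ℝ (gradient f y - gradient f x) (y - x) ≤ M * ‖y - x‖ ^ ν * ‖y - x‖ :=
    (real_inner_le_norm _ _).trans (mul_le_mul_of_nonneg_right (hQ y hy x hx) (norm_nonneg _))
  rw [inner_sub_left] at h1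
  have h2 : inner ℝ (gradient f y) (x - y) = - inner ℝ (gradient f y) (y - x) := by
    rw [← inner_neg_right, neg_sub]
  rw [mul_assoc] at h1
  linarith

/-- Strong convexity with parameter `μ` limits how flat the Hölder bound can be. -/
theorem IsStronglyConvex.mul_rpow_le (hf : IsStronglyConvex f μ) (hmin : ∀ x, f xs ≤ f x)
    (hn : 0 < n) {R : ℝ} (hR : 0 < R)
    (hQ : HasHolderGradientOn f ν M (Metric.closedBall xs (3 * R))) :
    μ * R ^ (1 - ν) ≤ M := by
  set y : EuclideanSpace ℝ (Fin n) := xs + EuclideanSpace.single ⟨0, hn⟩ R with hy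
  have hd : ‖y - xs‖ = R := by simp [hy, abs_of_pos hR]
  have hd' : ‖xs - y‖ = R := by rw [norm_sub_rev, hd]
  have h1 := hf.sq_dist_le hmin y
  have h2 := hf.lower_bound y xs
  have h3 := hQ y (by simp [dist_eq_norm, hd]; linarith) xs (by simp; linarith)
  rw [gradient_eq_zero_of_forall_le hmin, sub_zero, hd] at h3
  have h4 : -(‖gradient f y‖ * R) ≤ inner ℝ (gradient f y) (xs - y) := by
    have := abs_real_inner_le_norm (gradient f y) (xs - y)
    rw [hd'] at this
    exact (abs_le.1 this).1
  rw [hd] at h1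
  rw [hd'] at h2
  have h5 : ‖gradient f y‖ * R ≤ M * R ^ ν * R := mul_le_mul_of_nonneg_right h3 hR.le
  have h6 : μ * R * R ≤ M * R ^ ν * R := by nlinarith
  have h7 : μ * R ≤ M * R ^ ν := le_of_mul_le_mul_right h6 hR
  have h8 : R = R ^ (1 - ν) * R ^ ν := by
    rw [← Real.rpow_add hR]; simp
  rw [h8, ← mul_assoc, ← h8] at h7
  exact le_of_mul_le_mul_right h7 (by positivity)

end Convex

/-! ### The clipping operator -/

section Clip

variable {E : Type*} [NormedAddCommGroup E] [InnerProductSpace ℝ E] {v w : E} {l : ℝ}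

theorem clip_of_norm_le (h : ‖v‖ ≤ l) : clip v l = v := by
  rcases eq_or_ne v 0 with rfl | hv
  · simp [clip]
  · have : 1 ≤ l / ‖v‖ := (one_le_div (norm_pos_iff.2 hv)).2 h
    simp [clip, this]

theorem clip_of_lt_norm (h0 : 0 ≤ l) (h : l < ‖v‖) : clip v l = (l / ‖v‖) • v := by
  have : l / ‖v‖ ≤ 1 := (div_le_one (h0.trans_lt h)).2 h.le
  simp [clip, this]

theorem norm_clip_le (h0 : 0 ≤ l) : ‖clip v l‖ ≤ l := by
  rcases le_or_gt ‖v‖ l with h | h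
  · rwa [clip_of_norm_le h]
  · rw [clip_of_lt_norm h0 h, norm_smul, Real.norm_eq_abs, abs_of_nonneg (by positivity),
      div_mul_cancel₀ _ (h0.trans_lt h).ne']

/-- Clipping is the metric projection onto a ball, hence does not move a point away from any point
of that ball. -/
theorem norm_clip_sub_le (h0 : 0 ≤ l) (hw : ‖w‖ ≤ l) : ‖clip v l - w‖ ≤ ‖v - w‖ := by
  rcases le_or_gt ‖v‖ l with h | h
  · rw [clip_of_norm_le h]
  · rw [clip_of_lt_norm h0 h]
    have hv : 0 < ‖v‖ := h0.trans_lt h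
    set c := l / ‖v‖ with hc
    have hc1 : c ≤ 1 := (div_le_one hv).2 h.le
    have hcl : c * ‖v‖ = l := div_mul_cancel₀ _ hv.ne'
    refine le_of_sq_le_sq ?_ (norm_nonneg _)
    rw [@norm_sub_sq_real, @norm_sub_sq_real, real_inner_smul_left, norm_smul, Real.norm_eq_abs,
      abs_of_nonneg (by positivity : (0 : ℝ) ≤ c)]
    have h1 : inner ℝ v w ≤ ‖v‖ * (c * ‖v‖) :=
      (real_inner_le_norm _ _).trans (mul_le_mul_of_nonneg_left (hw.trans hcl.ge) hv.le)
    nlinarith [mul_nonneg (sub_nonneg.2 hc1) (sub_nonneg.2 h1),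
      mul_nonneg (sub_nonneg.2 hc1) (mul_nonneg (sub_nonneg.2 hc1) (sq_nonneg ‖v‖))]

/-- The bias of clipping is quadratic in the noise, when the true value is at most half the
clipping level. -/
theorem norm_clip_sub_self_le (h0 : 0 < l) (hw : ‖w‖ ≤ l / 2) :
    ‖clip v l - v‖ ≤ ‖v - w‖ ^ 2 / (2 * l) := by
  rcases le_or_gt ‖v‖ l with h | h
  · rw [clip_of_norm_le h]; simp; positivity
  · have hv : 0 < ‖v‖ := h0.trans h
    have h1 : clip v l - v = -((1 - l / ‖v‖) • v) := by
      rw [clip_of_lt_norm h0.le h]; module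
    have h2 : 0 ≤ 1 - l / ‖v‖ := by
      have := (div_le_one hv).2 h.le
      linarith
    have h3 : ‖clip v l - v‖ = ‖v‖ - l := by
      rw [h1, norm_neg, norm_smul, Real.norm_eq_abs, abs_of_nonneg h2]
      field_simp
    have h4 : ‖v‖ ≤ ‖v - w‖ + l / 2 := by
      have := norm_sub_norm_le v w
      linarith
    rw [h3, le_div_iff₀ (by positivity)]
    nlinarith [sq_nonneg (‖v - w‖ - l)]

end Clip

/-! ### One iteration -/

section Iteration

variable {n : ℕ} {f : EuclideanSpace ℝ (Fin n) → ℝ} {μ ν M : ℝ}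
  {xs x y z g y' z' : EuclideanSpace ℝ (Fin n)} {A α ε : ℝ}

/-- The decrease of the potential `‖z - x*‖² + 2 A (f y - f x*)` in one iteration, up to the
errors caused by the noise `g - ∇f x`. -/
theorem potential_step (hf : IsStronglyConvex f μ) (hμ : 0 ≤ μ) (hA : 0 ≤ A) (hα : 0 < α)
    (hx : (A + α) • x = A • y + α • z) (hz' : z' = z - α • g)
    (hy' : (A + α) • y' = A • y + α • z') {H : ℝ}
    (hd : f y' ≤ f x + inner ℝ (gradient f x) (y' - x) + H)
    (hH : (A + α) * H ≤ α ^ 2 * ‖g‖ ^ 2 / 2 + α * ε / 4) :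
    ‖z' - xs‖ ^ 2 + 2 * (A + α) * (f y' - f xs) ≤
      ‖z - xs‖ ^ 2 + 2 * A * (f y - f xs) + α * ε / 2 +
        (2 * α * inner ℝ (g - gradient f x) (xs - z + α • gradient f x) +
          2 * α ^ 2 * ‖g - gradient f x‖ ^ 2) := by
  set p := gradient f x with hp
  have h1 := hf.le_of_gradient hμ x y
  have h2 := hf.le_of_gradient hμ x xs
  rw [← hp] at h1 h2
  have e1 : (A + α) * inner ℝ p (y' - x) = -(α ^ 2 * inner ℝ p g) := by
    have : (A + α) • (y' - x) = -(α ^ 2 • g) := by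
      rw [smul_sub, hy', hx, hz']; module
    rw [← real_inner_smul_right, this, inner_neg_right, real_inner_smul_right]
  have e2 : A * inner ℝ p (y - x) + α * inner ℝ p (xs - x) = -(α * inner ℝ p (z - xs)) := by
    have : A • (y - x) + α • (xs - x) = -(α • (z - xs)) := by
      have : A • y = (A + α) • x - α • z := by rw [hx]; abel
      rw [smul_sub, this]; module
    rw [← real_inner_smul_right, ← real_inner_smul_right, ← inner_add_right, this,
      inner_neg_right, real_inner_smul_right]
  have e3 : ‖z' - xs‖ ^ 2 = ‖z - xs‖ ^ 2 - 2 * α * inner ℝ g (z - xs) + α ^ 2 * ‖g‖ ^ 2 := by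
    have : z' - xs = (z - xs) - α • g := by rw [hz']; abel
    rw [this, @norm_sub_sq_real, real_inner_smul_right, norm_smul, Real.norm_eq_abs, mul_pow,
      sq_abs, real_inner_comm]
    ring
  have e4 : inner ℝ (g - p) (xs - z + α • p) =
      -(inner ℝ g (z - xs)) + inner ℝ p (z - xs) + α * inner ℝ p g - α * ‖p‖ ^ 2 := by
    have : xs - z + α • p = -(z - xs) + α • p := by abel
    rw [this, inner_add_right, inner_neg_right, inner_sub_left, inner_sub_left,
      real_inner_smul_right, real_inner_smul_right, real_inner_self_eq_norm_sq,
      real_inner_comm p g]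
    ring
  have e5 : ‖g - p‖ ^ 2 = ‖g‖ ^ 2 - 2 * inner ℝ p g + ‖p‖ ^ 2 := by
    rw [@norm_sub_sq_real, real_inner_comm]
  have h3 : (A + α) * f y' ≤
      (A + α) * (f x + inner ℝ p (y' - x) + H) :=
    mul_le_mul_of_nonneg_left hd (by positivity)
  have h4 := mul_le_mul_of_nonneg_left h1 hA
  have h5 := mul_le_mul_of_nonneg_left h2 hα.le
  rw [e3, e4, e5]
  nlinarith [mul_nonneg (sq_nonneg α) (sq_nonneg ‖g‖)]

/-- A bound for the gap at the extrapolated point, linear in the gradient there. -/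
theorem mul_gap_le (hf : IsStronglyConvex f μ) (hμ : 0 ≤ μ) (hA : 0 ≤ A) (hα : 0 < α)
    (hx : (A + α) • x = A • y + α • z) {D : ℝ} (hz : ‖z - xs‖ ≤ D) :
    (A + α) * (f x - f xs) ≤ A * (f y - f xs) + D * (α * ‖gradient f x‖) := by
  set p := gradient f x with hp
  have h1 := hf.le_of_gradient hμ x y
  have h2 := hf.le_of_gradient hμ x xs
  rw [← hp] at h1 h2
  have e2 : A * inner ℝ p (y - x) + α * inner ℝ p (xs - x) = -(α * inner ℝ p (z - xs)) := by
    have : A • (y - x) + α • (xs - x) = -(α • (z - xs)) := by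
      have : A • y = (A + α) • x - α • z := by rw [hx]; abel
      rw [smul_sub, this]; module
    rw [← real_inner_smul_right, ← real_inner_smul_right, ← inner_add_right, this,
      inner_neg_right, real_inner_smul_right]
  have h3 : inner ℝ p (z - xs) ≤ ‖p‖ * D :=
    (real_inner_le_norm _ _).trans (mul_le_mul_of_nonneg_left hz (norm_nonneg _))
  have h4 := mul_le_mul_of_nonneg_left h1 hA
  have h5 := mul_le_mul_of_nonneg_left h2 hα.le
  have h6 := mul_le_mul_of_nonneg_left h3 hα.le
  nlinarith

/-- A gradient step of length `r` inside the region where the gradient is Hölder continuous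
bounds the gradient by the gap. -/
theorem mul_norm_gradient_le (hf : IsStronglyConvex f μ) (hμ : 0 ≤ μ)
    (hmin : ∀ x, f xs ≤ f x) (hM : 0 ≤ M) {ρ r : ℝ} (hx : ‖x - xs‖ + r ≤ ρ) (hr : 0 ≤ r)
    (hQ : HasHolderGradientOn f ν M (Metric.closedBall xs ρ)) :
    r * ‖gradient f x‖ ≤ f x - f xs + M * (r ^ ν * r) := by
  set p := gradient f x with hp
  rcases eq_or_ne p 0 with h0 | h0
  · have h1 := hmin x
    have : 0 ≤ M * (r ^ ν * r) := by positivity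
    simp only [h0, norm_zero, mul_zero]
    linarith
  · have hpn : 0 < ‖p‖ := norm_pos_iff.2 h0
    set w := x - (r / ‖p‖) • p with hw
    have hwx : w - x = -((r / ‖p‖) • p) := by rw [hw]; abel
    have hn : ‖w - x‖ = r := by
      rw [hwx, norm_neg, norm_smul, Real.norm_eq_abs, abs_of_nonneg (by positivity),
        div_mul_cancel₀ _ hpn.ne']
    have hwQ : w ∈ Metric.closedBall xs ρ := by
      rw [mem_closedBall_iff_norm]
      calc ‖w - xs‖ = ‖(w - x) + (x - xs)‖ := by congr 1; abel
        _ ≤ ‖w - x‖ + ‖x - xs‖ := norm_add_le _ _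
        _ ≤ ρ := by rw [hn]; linarith
    have hxQ : x ∈ Metric.closedBall xs ρ := by
      rw [mem_closedBall_iff_norm]; linarith
    have h1 := hf.le_add_holder hμ hQ hxQ hwQ
    rw [hn, hwx, inner_neg_right, real_inner_smul_right, ← hp, real_inner_self_eq_norm_sq] at h1
    have h2 : r / ‖p‖ * ‖p‖ ^ 2 = r * ‖p‖ := by field_simp
    have h3 := hmin w
    linarith

end Iteration

/-! ### Stepsizes -/

section StepSize

variable {ν α : ℝ}

theorem exponent_nonneg (hν : 0 ≤ ν) : 0 ≤ 2 * ν / (1 + ν) := by positivity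

theorem exponent_le_one (hν : 0 ≤ ν) (hν' : ν ≤ 1) : 2 * ν / (1 + ν) ≤ 1 := by
  rw [div_le_one (by positivity)]; linarith

theorem stepSize_succ (α ν : ℝ) (k : ℕ) :
    stepSize α ν (k + 1) = α * ((k : ℝ) + 1) ^ (2 * ν / (1 + ν)) := rfl

theorem stepSize_pos (hα : 0 < α) (k : ℕ) : 0 < stepSize α ν (k + 1) := by
  rw [stepSize_succ]; positivity

theorem stepSum_succ (α ν : ℝ) (k : ℕ) :
    stepSum α ν (k + 1) = stepSum α ν k + stepSize α ν (k + 1) := rfl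

theorem stepSum_nonneg (hα : 0 < α) (k : ℕ) : 0 ≤ stepSum α ν k := by
  induction k with
  | zero => exact le_rfl
  | succ k ih => rw [stepSum_succ]; exact add_nonneg ih (stepSize_pos hα k).le

theorem stepSum_pos (hα : 0 < α) (k : ℕ) : 0 < stepSum α ν (k + 1) := by
  rw [stepSum_succ]; exact add_pos_of_nonneg_of_pos (stepSum_nonneg hα k) (stepSize_pos hα k)

theorem stepSum_mono (hα : 0 < α) : Monotone (stepSum α ν) :=
  monotone_nat_of_le_succ fun k => by
    rw [stepSum_succ]; exact le_add_of_nonneg_right (stepSize_pos hα k).le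

theorem mul_stepSize_le (hν : 0 ≤ ν) (hν' : ν ≤ 1) (hα : 0 < α) (k : ℕ) :
    ((k : ℝ) + 1) * stepSize α ν (k + 1) ≤ 2 * stepSum α ν (k + 1) := by
  induction k with
  | zero =>
    have := stepSize_pos (ν := ν) hα 0
    simp [stepSum]
    simp at this
    linarith
  | succ k ih =>
    rw [stepSum_succ _ _ (k + 1)]
    -- the quotient of consecutive stepsizes is at most the quotient of the indices
    have h1 : ((k : ℝ) + 1) * stepSize α ν (k + 1 + 1) ≤ ((k : ℝ) + 2) * stepSize α ν (k + 1) := by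
      have hq : (((k : ℝ) + 2) / (k + 1)) ^ (2 * ν / (1 + ν)) ≤
        (((k : ℝ) + 2) / (k + 1)) ^ (1 : ℝ) :=
        Real.rpow_le_rpow_of_exponent_le
          ((one_le_div (by positivity)).2 (by linarith)) (exponent_le_one hν hν')
      rw [Real.rpow_one, Real.div_rpow (by positivity) (by positivity),
        div_le_div_iff₀ (by positivity) (by positivity)] at hq
      rw [stepSize_succ, stepSize_succ]
      push_cast
      rw [show (k : ℝ) + 1 + 1 = k + 2 by ring]
      nlinarith
    have h2 := stepSize_pos (ν := ν) hα k
    have h3 := stepSize_pos (ν := ν) hα (k + 1)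
    push_cast
    have h4 : (k : ℝ) * stepSize α ν (k + 1 + 1) ≤ (k + 1) * stepSize α ν (k + 1) := by
      have hk : (0 : ℝ) < k + 1 := by positivity
      refine le_of_mul_le_mul_left ?_ hk
      nlinarith [mul_le_mul_of_nonneg_left h1 (Nat.cast_nonneg (α := ℝ) k)]
    linarith

theorem stepSize_mono (hν : 0 ≤ ν) (hα : 0 < α) {j k : ℕ} (h : j ≤ k) :
    stepSize α ν (j + 1) ≤ stepSize α ν (k + 1) := by
  rw [stepSize_succ, stepSize_succ]
  have : (j : ℝ) ≤ k := by exact_mod_cast h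
  gcongr

theorem stepSum_le_mul (hν : 0 ≤ ν) (hα : 0 < α) (k : ℕ) :
    stepSum α ν (k + 1) ≤ (k + 1) * stepSize α ν (k + 1) := by
  induction k with
  | zero => simp [stepSum]
  | succ k ih =>
    rw [stepSum_succ]
    have := stepSize_mono hν hα (Nat.le_succ k)
    push_cast
    nlinarith [mul_le_mul_of_nonneg_left this (by positivity : (0 : ℝ) ≤ k + 1)]

theorem stepSize_le_mul (hν : 0 ≤ ν) (hν' : ν ≤ 1) (hα : 0 < α) (k : ℕ) :
    stepSize α ν (k + 1) ≤ α * (k + 1) := by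
  rw [stepSize_succ]
  have := Real.rpow_le_rpow_of_exponent_le (x := (k : ℝ) + 1) (by simp) (exponent_le_one hν hν')
  rw [Real.rpow_one] at this
  gcongr

end StepSize

/-! ### The parameters of a single run -/

/-- The consequences of the choice of the parameters that the analysis of one run of `N`
iterations uses. Here `R` bounds the distance of the starting point to the minimizer, `ε` is the
target accuracy, and `L` stands for the logarithm in the parameters. The field `young` absorbs the
Hölder remainder of the descent inequality, `growth` says that the stepsizes grow at most linearly,
`lower` and `upper` say that `A_N ε` is of the order of `R²`, and `small` bounds the scaled gradients
in the early iterations. -/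
structure RunBounds (ν M R ε L α : ℝ) (N : ℕ) : Prop where
  R_pos : 0 < R
  eps_pos : 0 < ε
  M_pos : 0 < M
  nu_nonneg : 0 ≤ ν
  two_le : 2 ≤ L
  alpha_pos : 0 < α
  N_pos : 0 < N
  young : ∀ (k : ℕ) (r : ℝ), 0 ≤ r →
    stepSum α ν (k + 1) * (M * (r ^ ν * r)) ≤
      (stepSum α ν (k + 1) * r) ^ 2 / (16384 * L ^ 2 * stepSize α ν (k + 1) ^ 2) +
        stepSize α ν (k + 1) * ε / 4
  growth : ∀ k : ℕ, ((k : ℝ) + 1) * stepSize α ν (k + 1) ≤ 2 * stepSum α ν (k + 1)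
  lower : 7 / 2 * R ^ 2 ≤ stepSum α ν N * ε
  upper : stepSum α ν N * ε ≤ 73 / 10 * R ^ 2
  small : ∀ k : ℕ, stepSize α ν (k + 1) * (M * (constC * R) ^ ν) ≤
    (k + 1) * (constC * R) / (2 * (16384 * L ^ 2))

theorem constC_sq : constC ^ 2 = 7 := by rw [constC, Real.sq_sqrt (by norm_num)]

theorem constC_pos : 0 < constC := Real.sqrt_pos.2 (by norm_num)

section Parameters

variable {ν M R ε a α : ℝ}

/-- The stepsize parameter balances the two terms of the weighted arithmetic-geometric mean
inequality, so that the Hölder continuous gradient behaves like a Lipschitz continuous one up to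
an error proportional to `ε`. -/
theorem young_of_alpha (hν : 0 ≤ ν) (hν' : ν ≤ 1) (hM : 0 < M) (hε : 0 < ε) (ha : 0 < a)
    (hα : α = (ε / 2) ^ ((1 - ν) / (1 + ν)) /
      ((2 : ℝ) ^ (2 * ν / (1 + ν)) * a * M ^ (2 / (1 + ν))))
    (k : ℕ) {r : ℝ} (hr : 0 ≤ r) :
    stepSum α ν (k + 1) * (M * (r ^ ν * r)) ≤
      (stepSum α ν (k + 1) * r) ^ 2 / (a * stepSize α ν (k + 1) ^ 2) +
        stepSize α ν (k + 1) * ε / 4 := by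
  have hα0 : 0 < α := by rw [hα]; positivity
  have hgr := mul_stepSize_le hν hν' hα0 k
  have hA := stepSum_pos (ν := ν) hα0 k
  have hs := stepSize_pos (ν := ν) hα0 k
  have hss := stepSize_succ α ν k
  set A := stepSum α ν (k + 1)
  set s := stepSize α ν (k + 1)
  rcases hr.eq_or_lt with rfl | hr
  · have : 0 < s * ε := by positivity
    simp; linarith
  have h1ν : 1 + ν ≠ 0 := by positivity
  have hm : (0 : ℝ) < (k : ℝ) + 1 := by positivity
  set m := (k : ℝ) + 1
  have key : A * (M * (r ^ ν * r)) ≤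
      ((A * r) ^ 2 / (a * s ^ 2)) ^ ((1 + ν) / 2) * (s * ε / 2) ^ ((1 - ν) / 2) := by
    -- all bases are positive, so that the identity of powers is one of exponents
    have e : ((A * r) ^ 2 / (a * s ^ 2)) ^ ((1 + ν) / 2) * (s * ε / 2) ^ ((1 - ν) / 2) =
        A * (M * (r ^ ν * r)) * ((2 * A) / (m * s)) ^ ν := by
      have h2 : (2 : ℝ) = Real.exp (Real.log 2) := (Real.exp_log (by norm_num)).symm
      have hr' := (Real.exp_log hr).symm
      have hA' := (Real.exp_log hA).symm
      have hM' := (Real.exp_log hM).symm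
      have ha' := (Real.exp_log ha).symm
      have hm' := (Real.exp_log hm).symm
      have hε' : ε / 2 = Real.exp (Real.log (ε / 2)) := (Real.exp_log (by positivity)).symm
      generalize Real.log r = lr at hr'
      generalize Real.log A = lA at hA'
      generalize Real.log M = lM at hM'
      generalize Real.log a = la at ha'
      generalize Real.log m = lm at hm'
      generalize Real.log (ε / 2) = lε at hε'
      rw [mul_div_assoc s ε 2, hss, hα, hε', hA', hr', hM', ha', hm']
      rw [← Real.rpow_natCast, ← Real.rpow_natCast]
      generalize Real.log 2 = l2 at h2
      have h2' : (2 : ℝ) ^ (2 * ν / (1 + ν)) = Real.exp (l2 * (2 * ν / (1 + ν))) := by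
        rw [h2, ← Real.exp_mul]
      have h2'' : 2 * Real.exp lA = Real.exp (l2 + lA) := by rw [Real.exp_add, ← h2]
      rw [h2', h2'']
      simp only [← Real.exp_mul, ← Real.exp_add, ← Real.exp_sub]
      congr 1
      push_cast
      field_simp
      ring
    rw [e]
    -- the additional factor exceeds `1` by the linear growth of the stepsizes
    refine le_mul_of_one_le_right (by positivity) (Real.one_le_rpow ?_ hν)
    rw [one_le_div (by positivity)]
    exact hgr
  refine key.trans ?_
  have h1 := Real.geom_mean_le_arith_mean2_weighted (w₁ := (1 + ν) / 2) (w₂ := (1 - ν) / 2)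
    (p₁ := (A * r) ^ 2 / (a * s ^ 2)) (p₂ := s * ε / 2) (by linarith) (by linarith)
    (by positivity) (by positivity) (by ring)
  refine h1.trans (add_le_add ?_ ?_)
  · exact mul_le_of_le_one_left (by positivity) (by linarith)
  · have : 0 < s * ε := by positivity
    nlinarith

/-- The bound for the early scaled gradients. The assumption on `ε` follows from strong convexity
together with the Hölder condition. -/
theorem alpha_mul_le (hν : 0 ≤ ν) (hν' : ν ≤ 1) (hM : 0 < M) (hε : 0 < ε) (ha : 0 < a)
    (hR : 0 < R)
    (hα : α = (ε / 2) ^ ((1 - ν) / (1 + ν)) /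
      ((2 : ℝ) ^ (2 * ν / (1 + ν)) * a * M ^ (2 / (1 + ν))))
    (hεM : ε ≤ M * R ^ (1 + ν)) :
    α * (M * (constC * R) ^ ν) ≤ constC * R / (2 * a) := by
  have h1 : (ε / 2) ^ ((1 - ν) / (1 + ν)) ≤ (M * R ^ (1 + ν) / 2) ^ ((1 - ν) / (1 + ν)) := by
    gcongr
  have h2 : (M * R ^ (1 + ν) / 2) ^ ((1 - ν) / (1 + ν)) /
      ((2 : ℝ) ^ (2 * ν / (1 + ν)) * a * M ^ (2 / (1 + ν))) = R ^ (1 - ν) / (2 * a * M) := by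
    have hM' := (Real.exp_log hM).symm
    have ha' := (Real.exp_log ha).symm
    have hR' := (Real.exp_log hR).symm
    generalize Real.log M = lM at hM'
    generalize Real.log a = la at ha'
    generalize Real.log R = lR at hR'
    have h2 : (2 : ℝ) = Real.exp (Real.log 2) := (Real.exp_log (by norm_num)).symm
    generalize Real.log 2 = l2 at h2
    have h2' : (2 : ℝ) ^ (2 * ν / (1 + ν)) = Real.exp (l2 * (2 * ν / (1 + ν))) := by
      rw [h2, ← Real.exp_mul]
    have h2'' (x : ℝ) : 2 * Real.exp x = Real.exp (l2 + x) := by rw [Real.exp_add, ← h2]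
    have h2''' (x : ℝ) : Real.exp x / 2 = Real.exp (x - l2) := by rw [Real.exp_sub, ← h2]
    rw [hM', ha', hR', h2', h2'']
    simp only [← Real.exp_mul, ← Real.exp_add, ← Real.exp_sub, h2''']
    congr 1
    field_simp
    ring
  have h3 : α ≤ R ^ (1 - ν) / (2 * a * M) := by
    rw [hα, ← h2]; gcongr
  have hC : 1 ≤ constC := by
    rw [constC, Real.one_le_sqrt]; norm_num
  have h4 : R ^ (1 - ν) ≤ (constC * R) ^ (1 - ν) := by
    gcongr
    exact le_mul_of_one_le_left hR.le hC
  have hCR : 0 < constC * R := mul_pos constC_pos hR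
  calc α * (M * (constC * R) ^ ν)
      ≤ (constC * R) ^ (1 - ν) / (2 * a * M) * (M * (constC * R) ^ ν) := by
        gcongr
        exact h3.trans (by gcongr)
    _ = ((constC * R) ^ (1 - ν) * (constC * R) ^ ν) / (2 * a) := by field_simp
    _ = constC * R / (2 * a) := by
        rw [← Real.rpow_add hCR]; simp

/-- The number of iterations is chosen such that `α N^{1 + 2ν/(1+ν)} ε` is about `C² R²`. -/
theorem alpha_mul_rpow_mul (hν : 0 ≤ ν) (hM : 0 < M) (hε : 0 < ε) (ha : 0 < a)
    (hR : 0 < R)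
    (hα : α = (ε / 2) ^ ((1 - ν) / (1 + ν)) /
      ((2 : ℝ) ^ (2 * ν / (1 + ν)) * a * M ^ (2 / (1 + ν)))) {X : ℝ}
    (hX : X = (2 * a) ^ ((1 + ν) / (1 + 3 * ν)) * (constC * R) ^ (2 * (1 + ν) / (1 + 3 * ν)) *
      M ^ (2 / (1 + 3 * ν)) / ε ^ (2 / (1 + 3 * ν))) :
    α * X ^ (1 + 2 * ν / (1 + ν)) * ε = 7 * R ^ 2 := by
  rw [show (7 : ℝ) * R ^ 2 = (constC * R) ^ 2 by rw [mul_pow, constC_sq]]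
  have hCR : 0 < constC * R := mul_pos constC_pos hR
  generalize constC * R = D at *
  have hM' := (Real.exp_log hM).symm
  have ha' := (Real.exp_log ha).symm
  have hD' := (Real.exp_log hCR).symm
  have hε' := (Real.exp_log hε).symm
  generalize Real.log M = lM at hM'
  generalize Real.log a = la at ha'
  generalize Real.log D = lD at hD'
  generalize Real.log ε = lε at hε'
  have h2 : (2 : ℝ) = Real.exp (Real.log 2) := (Real.exp_log (by norm_num)).symm
  generalize Real.log 2 = l2 at h2
  have h2' : (2 : ℝ) ^ (2 * ν / (1 + ν)) = Real.exp (l2 * (2 * ν / (1 + ν))) := by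
    rw [h2, ← Real.exp_mul]
  have h2'' (x : ℝ) : 2 * Real.exp x = Real.exp (l2 + x) := by rw [Real.exp_add, ← h2]
  have h2''' (x : ℝ) : Real.exp x / 2 = Real.exp (x - l2) := by rw [Real.exp_sub, ← h2]
  rw [hX, hα, ← Real.rpow_natCast, hM', ha', hD', h2', hε', h2''']
  rw [h2'']
  simp only [← Real.exp_mul, ← Real.exp_add, ← Real.exp_sub]
  congr 1
  push_cast
  field_simp
  ring

theorem runBounds {L : ℝ} {N : ℕ} (hν : 0 ≤ ν) (hν' : ν ≤ 1) (hM : 0 < M) (hε : 0 < ε)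
    (hR : 0 < R) (hL : 2 ≤ L)
    (hα : α = (ε / 2) ^ ((1 - ν) / (1 + ν)) /
      ((2 : ℝ) ^ (2 * ν / (1 + ν)) * (16384 * L ^ 2) * M ^ (2 / (1 + ν)))) {X : ℝ}
    (hX : X = (2 * (16384 * L ^ 2)) ^ ((1 + ν) / (1 + 3 * ν)) *
      (constC * R) ^ (2 * (1 + ν) / (1 + 3 * ν)) * M ^ (2 / (1 + 3 * ν)) / ε ^ (2 / (1 + 3 * ν)))
    (hN : N = ⌈X⌉₊ + 1) (hX100 : 100 ≤ X) (hεM : ε ≤ M * R ^ (1 + ν)) :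
    RunBounds ν M R ε L α N := by
  have ha : 0 < 16384 * L ^ 2 := by positivity
  have hα0 : 0 < α := by rw [hα]; positivity
  have hXi := alpha_mul_rpow_mul hν hM hε ha hR hα hX
  have hX0 : 0 < X := by linarith
  have hq0 := exponent_nonneg hν
  have hq1 := exponent_le_one hν hν'
  have hNs : stepSize α ν N * N = α * (N : ℝ) ^ (1 + 2 * ν / (1 + ν)) := by
    rw [hN, stepSize_succ]
    push_cast
    rw [Real.rpow_add (by positivity), Real.rpow_one]
    ring
  have hXN : X ≤ N := by
    rw [hN]; push_cast; linarith [Nat.le_ceil X]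
  -- rounding changes `X ≥ 100` by at most two
  have hNX : (N : ℝ) ≤ 1.02 * X := by
    rw [hN]; push_cast; linarith [Nat.ceil_lt_add_one hX0.le]
  have hlow : 7 * R ^ 2 ≤ stepSize α ν N * N * ε := by
    rw [hNs, ← hXi]; gcongr
  have hupp : stepSize α ν N * N * ε ≤ 73 / 10 * R ^ 2 := by
    rw [hNs]
    have h1 : (N : ℝ) ^ (1 + 2 * ν / (1 + ν)) ≤ (1.02 * X) ^ (1 + 2 * ν / (1 + ν)) := by gcongr
    rw [Real.mul_rpow (by norm_num) hX0.le] at h1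
    have h2 : (1.02 : ℝ) ^ (1 + 2 * ν / (1 + ν)) ≤ 1.0404 := by
      calc (1.02 : ℝ) ^ (1 + 2 * ν / (1 + ν)) ≤ (1.02 : ℝ) ^ (2 : ℝ) :=
            Real.rpow_le_rpow_of_exponent_le (by norm_num) (by linarith)
        _ = 1.0404 := by rw [Real.rpow_two]; norm_num
    calc α * (N : ℝ) ^ (1 + 2 * ν / (1 + ν)) * ε
        ≤ α * (1.0404 * X ^ (1 + 2 * ν / (1 + ν))) * ε := by
          gcongr
          exact h1.trans (by gcongr)
      _ = 1.0404 * (α * X ^ (1 + 2 * ν / (1 + ν)) * ε) := by ring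
      _ ≤ 73 / 10 * R ^ 2 := by rw [hXi]; nlinarith [sq_nonneg R]
  refine ⟨hR, hε, hM, hν, hL, hα0, by omega, fun k r hr => young_of_alpha hν hν' hM hε ha hα k hr,
    mul_stepSize_le hν hν' hα0, ?_, ?_, fun k => ?_⟩
  · have := mul_stepSize_le hν hν' hα0 ⌈X⌉₊
    have h3 : (N : ℝ) = (⌈X⌉₊ : ℝ) + 1 := by rw [hN]; push_cast; rfl
    rw [← h3, ← hN] at this
    nlinarith
  · have := stepSum_le_mul hν hα0 ⌈X⌉₊
    have h3 : (N : ℝ) = (⌈X⌉₊ : ℝ) + 1 := by rw [hN]; push_cast; rfl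
    rw [← h3, ← hN] at this
    nlinarith
  · have h1 := stepSize_le_mul hν hν' hα0 k
    have h2 := alpha_mul_le hν hν' hM hε ha hR hα hεM
    have hCR : 0 < constC * R := mul_pos constC_pos hR
    calc stepSize α ν (k + 1) * (M * (constC * R) ^ ν)
        ≤ α * (k + 1) * (M * (constC * R) ^ ν) := by gcongr
      _ = (k + 1) * (α * (M * (constC * R) ^ ν)) := by ring
      _ ≤ (k + 1) * (constC * R / (2 * (16384 * L ^ 2))) := by gcongr
      _ = _ := by ring

end Parameters

/-! ### The iterates near the minimizer -/

section GoodStates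

variable {n : ℕ} {f : EuclideanSpace ℝ (Fin n) → ℝ} {μ ν M R ε L α : ℝ} {N k : ℕ}
  {xs y z : EuclideanSpace ℝ (Fin n)}

/-- The point `x^{k+1}` at which iteration `k` evaluates the stochastic gradient. -/
noncomputable def extrapolation {E : Type*} [NormedAddCommGroup E] [NormedSpace ℝ E] (ν α : ℝ) (k : ℕ)
    (y z : E) : E :=
  (stepSum α ν (k + 1))⁻¹ • (stepSum α ν k • y + stepSize α ν (k + 1) • z)

/-- The states `(y^k, z^k)` from which the analysis of iteration `k` proceeds. Here `D` is a
radius. -/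
structure IsGood (f : EuclideanSpace ℝ (Fin n) → ℝ) (xs : EuclideanSpace ℝ (Fin n))
    (ν α D : ℝ) (k : ℕ) (y z : EuclideanSpace ℝ (Fin n)) : Prop where
  norm_y : ‖y - xs‖ ≤ D
  norm_z : ‖z - xs‖ ≤ D
  gap : 2 * stepSum α ν k * (f y - f xs) ≤ D ^ 2

/-- The potential function `‖z - x*‖² + 2 A_k (f y - f x*) - A_k ε / 2`. -/
noncomputable def potential (f : EuclideanSpace ℝ (Fin n) → ℝ) (xs : EuclideanSpace ℝ (Fin n))
    (ν α ε : ℝ) (k : ℕ) (y z : EuclideanSpace ℝ (Fin n)) : ℝ :=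
  ‖z - xs‖ ^ 2 + 2 * stepSum α ν k * (f y - f xs) - stepSum α ν k * ε / 2

theorem smul_extrapolation {E : Type*} [NormedAddCommGroup E] [NormedSpace ℝ E] (hα : 0 < α)
    (y z : E) : (stepSum α ν k + stepSize α ν (k + 1)) • extrapolation ν α k y z =
      stepSum α ν k • y + stepSize α ν (k + 1) • z := by
  rw [extrapolation, ← stepSum_succ, smul_inv_smul₀ (stepSum_pos hα k).ne']

theorem norm_extrapolation_sub_le (hα : 0 < α) {D : ℝ} (hy : ‖y - xs‖ ≤ D) (hz : ‖z - xs‖ ≤ D) :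
    ‖extrapolation ν α k y z - xs‖ ≤ D := by
  have hA := stepSum_nonneg (ν := ν) hα k
  have hs := stepSize_pos (ν := ν) hα k
  have hA' := stepSum_pos (ν := ν) hα k
  have h1 : extrapolation ν α k y z - xs = (stepSum α ν (k + 1))⁻¹ •
      (stepSum α ν k • (y - xs) + stepSize α ν (k + 1) • (z - xs)) := by
    rw [eq_inv_smul_iff₀ hA'.ne', smul_sub, stepSum_succ, smul_extrapolation hα]
    module
  rw [h1, norm_smul, norm_inv, Real.norm_eq_abs, abs_of_pos hA', inv_mul_le_iff₀ hA']
  calc _ ≤ ‖stepSum α ν k • (y - xs)‖ + ‖stepSize α ν (k + 1) • (z - xs)‖ := norm_add_le _ _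
    _ = stepSum α ν k * ‖y - xs‖ + stepSize α ν (k + 1) * ‖z - xs‖ := by
      rw [norm_smul, norm_smul, Real.norm_eq_abs, Real.norm_eq_abs, abs_of_nonneg hA,
        abs_of_pos hs]
    _ ≤ stepSum α ν k * D + stepSize α ν (k + 1) * D := by gcongr
    _ = stepSum α ν (k + 1) * D := by rw [stepSum_succ]; ring

/-- The iterates, at distance at most `17/16 · √7 R` from the minimizer, stay in the ball on which
the gradient is Hölder continuous. -/
theorem constC_mul_le (hR : 0 ≤ R) : 17 / 16 * (constC * R) ≤ 3 * R := by
  have : constC ≤ 48 / 17 := by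
    rw [constC, Real.sqrt_le_left (by norm_num)]; norm_num
  nlinarith

/-- On good states the scaled gradient is at most half the clipping level. In the first
iterations this follows from the Hölder condition, with the minimizer as the other point; later a
gradient step of length `r` stays inside the ball `B_{3R}(x*)`. -/
theorem RunBounds.mul_norm_gradient_le (hp : RunBounds ν M R ε L α N)
    (hf : IsStronglyConvex f μ) (hμ : 0 ≤ μ) (hmin : ∀ x, f xs ≤ f x)
    (hQ : HasHolderGradientOn f ν M (Metric.closedBall xs (3 * R))) (hk : k < N)
    (hg : IsGood f xs ν α (constC * R) k y z) :
    stepSize α ν (k + 1) * ‖gradient f (extrapolation ν α k y z)‖ ≤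
      constC * R / (16 * L) / 2 := by
  have hα := hp.alpha_pos
  have hL := hp.two_le
  have hR := hp.R_pos
  have hL0 : 0 < L := by linarith
  have hs := stepSize_pos (ν := ν) hα k
  have hA := stepSum_nonneg (ν := ν) hα k
  have hA' := stepSum_pos (ν := ν) hα k
  have hDR : (constC * R) ^ 2 = 7 * R ^ 2 := by rw [mul_pow, constC_sq]
  have h3R := constC_mul_le hR.le
  have hD : 0 < constC * R := mul_pos constC_pos hR
  have hsm := hp.small k
  have hgr := hp.growth k
  have hx := norm_extrapolation_sub_le (ν := ν) (k := k) hα hg.norm_y hg.norm_z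
  have hxe := smul_extrapolation (ν := ν) (k := k) hα y z
  set x := extrapolation ν α k y z
  set D := constC * R
  rcases le_or_gt ((k : ℝ) + 1) (1024 * L) with hkL | hkL
  · have h1 : ‖gradient f x‖ ≤ M * D ^ ν := by
      have h2 := hQ x (by rw [mem_closedBall_iff_norm]; linarith) xs (by simp; linarith)
      rw [gradient_eq_zero_of_forall_le hmin, sub_zero] at h2
      refine h2.trans ?_
      have := hp.nu_nonneg
      have := hp.M_pos
      gcongr
    calc stepSize α ν (k + 1) * ‖gradient f x‖
        ≤ stepSize α ν (k + 1) * (M * D ^ ν) := by gcongr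
      _ ≤ (k + 1) * D / (2 * (16384 * L ^ 2)) := hsm
      _ ≤ (1024 * L) * D / (2 * (16384 * L ^ 2)) := by gcongr
      _ = D / (16 * L) / 2 := by field_simp; norm_num
  · -- the length `r` makes the scaled gradient appear with the large factor `32 L D`
    set r := stepSize α ν (k + 1) * (32 * L * D) / stepSum α ν (k + 1) with hr
    have hr0 : 0 ≤ r := by positivity
    have hAr : stepSum α ν (k + 1) * r = stepSize α ν (k + 1) * (32 * L * D) := by
      rw [hr]; field_simp
    have hr1 : r ≤ D / 16 := by
      rw [hr, div_le_iff₀ hA']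
      have : 1024 * L * stepSize α ν (k + 1) ≤ 2 * stepSum α ν (k + 1) :=
        (mul_le_mul_of_nonneg_right hkL.le hs.le).trans hgr
      nlinarith
    have h1 := ClippedSSTM.mul_norm_gradient_le hf hμ hmin hp.M_pos.le
      (x := x) (r := r) (ρ := 3 * R) (by linarith) hr0 hQ
    have h2 := hp.young k r hr0
    rw [hAr] at h2
    have h3 := mul_gap_le hf hμ hA hs hxe hg.norm_z
    have h4 := hg.gap
    rw [← stepSum_succ] at h3
    have h5 : stepSize α ν (k + 1) * ε ≤ 73 / 10 * R ^ 2 := by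
      refine le_trans ?_ hp.upper
      have h6 : stepSize α ν (k + 1) ≤ stepSum α ν (k + 1) := by rw [stepSum_succ]; linarith
      exact mul_le_mul_of_nonneg_right (h6.trans (stepSum_mono hα hk)) hp.eps_pos.le
    have h6 : (stepSize α ν (k + 1) * (32 * L * D)) ^ 2 /
        (16384 * L ^ 2 * stepSize α ν (k + 1) ^ 2) = D ^ 2 / 16 := by
      field_simp; norm_num
    rw [h6] at h2
    have h7 := mul_le_mul_of_nonneg_left h1 hA'.le
    have h8 : stepSum α ν (k + 1) * (r * ‖gradient f x‖) =
        32 * L * D * (stepSize α ν (k + 1) * ‖gradient f x‖) := by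
      rw [← mul_assoc, hAr]; ring
    rw [h8] at h7
    set u := stepSize α ν (k + 1) * ‖gradient f x‖
    have h9 : D * ((32 * L - 1) * u) ≤ D * (83 / 100 * D) := by nlinarith
    have h10 := le_of_mul_le_mul_left h9 hD
    rw [div_div, le_div_iff₀ (by positivity)]
    nlinarith

/-- The contribution of the noise of iteration `k` to the potential. -/
noncomputable def noiseTerm {Ξ : Type*} (f : EuclideanSpace ℝ (Fin n) → ℝ)
    (G : EuclideanSpace ℝ (Fin n) → Ξ → EuclideanSpace ℝ (Fin n))
    (xs : EuclideanSpace ℝ (Fin n)) (ν α B : ℝ) (k m : ℕ) (s : ℕ → Ξ)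
    (y z : EuclideanSpace ℝ (Fin n)) : ℝ :=
  2 * stepSize α ν (k + 1) *
      inner ℝ (clip (miniBatch G m s (extrapolation ν α k y z)) (B / stepSize α ν (k + 1)) -
          gradient f (extrapolation ν α k y z))
        (xs - z + stepSize α ν (k + 1) • gradient f (extrapolation ν α k y z)) +
    2 * stepSize α ν (k + 1) ^ 2 *
      ‖clip (miniBatch G m s (extrapolation ν α k y z)) (B / stepSize α ν (k + 1)) -
          gradient f (extrapolation ν α k y z)‖ ^ 2

/-- On good states the potential increases by at most the noise term. -/
theorem RunBounds.potential_step (hp : RunBounds ν M R ε L α N)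
    (hf : IsStronglyConvex f μ) (hμ : 0 ≤ μ)
    (hQ : HasHolderGradientOn f ν M (Metric.closedBall xs (3 * R)))
    {Ξ : Type*} (G : EuclideanSpace ℝ (Fin n) → Ξ → EuclideanSpace ℝ (Fin n)) (m : ℕ) (s : ℕ → Ξ)
    {S : State (EuclideanSpace ℝ (Fin n))}
    (hg : IsGood f xs ν α (constC * R) k S.y S.z) :
    potential f xs ν α ε (k + 1) (step G ν α (constC * R / (16 * L)) k m s S).y
        (step G ν α (constC * R / (16 * L)) k m s S).z ≤
      potential f xs ν α ε k S.y S.z +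
        noiseTerm f G xs ν α (constC * R / (16 * L)) k m s S.y S.z := by
  have hα := hp.alpha_pos
  have hL := hp.two_le
  have hR := hp.R_pos
  have hL0 : 0 < L := by linarith
  have hs := stepSize_pos (ν := ν) hα k
  have hA := stepSum_nonneg (ν := ν) hα k
  have hA' := stepSum_pos (ν := ν) hα k
  have h3R := constC_mul_le hR.le
  have hD : 0 < constC * R := mul_pos constC_pos hR
  have hx := norm_extrapolation_sub_le (ν := ν) (k := k) hα hg.norm_y hg.norm_z
  have hxe := smul_extrapolation (ν := ν) (k := k) hα S.y S.z
  have hy1 := hg.norm_y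
  have hz1 := hg.norm_z
  have hye : (step G ν α (constC * R / (16 * L)) k m s S).y =
    extrapolation ν α k S.y (step G ν α (constC * R / (16 * L)) k m s S).z := rfl
  have hze : (step G ν α (constC * R / (16 * L)) k m s S).z =
    S.z - stepSize α ν (k + 1) • clip (miniBatch G m s (extrapolation ν α k S.y S.z))
      (constC * R / (16 * L) / stepSize α ν (k + 1)) := rfl
  rw [hye]
  generalize (step G ν α (constC * R / (16 * L)) k m s S).z = z' at *
  have hyoung := hp.young k
  unfold noiseTerm
  set x := extrapolation ν α k S.y S.z
  set D := constC * R
  set g := clip (miniBatch G m s x) (D / (16 * L) / stepSize α ν (k + 1))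
  have hgn : stepSize α ν (k + 1) * ‖g‖ ≤ D / (16 * L) := by
    have : ‖g‖ ≤ D / (16 * L) / stepSize α ν (k + 1) := norm_clip_le (by positivity)
    rwa [le_div_iff₀ hs, mul_comm] at this
  have hB : D / (16 * L) ≤ D / 16 := by
    gcongr; linarith
  have hz2 : ‖z' - xs‖ ≤ 17 / 16 * D := by
    have : z' - xs = (S.z - xs) - stepSize α ν (k + 1) • g := by rw [hze]; abel
    rw [this]
    refine (norm_sub_le _ _).trans ?_
    rw [norm_smul, Real.norm_eq_abs, abs_of_pos hs]
    linarith
  have hy2 := norm_extrapolation_sub_le (ν := ν) (k := k) hα (y := S.y) (z := z') (xs := xs)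
    (D := 17 / 16 * D) (by linarith) hz2
  have hy'e := smul_extrapolation (ν := ν) (k := k) hα S.y z'
  set y' := extrapolation ν α k S.y z'
  have hd := hf.le_add_holder hμ hQ (x := x) (y := y')
    (by rw [mem_closedBall_iff_norm]; linarith) (by rw [mem_closedBall_iff_norm]; linarith)
  have hyx : stepSum α ν (k + 1) * ‖y' - x‖ = stepSize α ν (k + 1) ^ 2 * ‖g‖ := by
    have h1 : stepSum α ν (k + 1) • (y' - x) = -(stepSize α ν (k + 1) ^ 2 • g) := by
      rw [stepSum_succ, smul_sub, hy'e, hxe, hze]; module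
    have h2 := congrArg norm h1
    rwa [norm_neg, norm_smul, norm_smul, Real.norm_eq_abs, Real.norm_eq_abs, abs_of_pos hA',
      abs_of_pos (by positivity)] at h2
  have hy := hyoung ‖y' - x‖ (norm_nonneg _)
  have hH : (stepSum α ν k + stepSize α ν (k + 1)) * (M * (‖y' - x‖ ^ ν * ‖y' - x‖)) ≤
      stepSize α ν (k + 1) ^ 2 * ‖g‖ ^ 2 / 2 + stepSize α ν (k + 1) * ε / 4 := by
    rw [hyx] at hy
    rw [← stepSum_succ]
    refine hy.trans (add_le_add_left ?_ _)
    have h1 : (stepSize α ν (k + 1) ^ 2 * ‖g‖) ^ 2 / (16384 * L ^ 2 * stepSize α ν (k + 1) ^ 2) =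
        stepSize α ν (k + 1) ^ 2 * ‖g‖ ^ 2 / (16384 * L ^ 2) := by field_simp
    rw [h1]
    gcongr
    nlinarith
  have h := ClippedSSTM.potential_step (ε := ε) (xs := xs) hf hμ hA hs hxe hze hy'e hd hH
  unfold potential
  rw [stepSum_succ]
  linarith

end GoodStates

/-! ### The exponential moment of the noise -/

section Noise

variable {E : Type*} [NormedAddCommGroup E] [InnerProductSpace ℝ E] {D L s : ℝ} {g p v : E}

/-- A pointwise bound of the exponential of the noise term by an affine function and the square of
the unclipped noise `g - p`, where `p` is the true gradient. -/
theorem exp_noise_le (hD : 0 < D) (hL : 2 ≤ L) (hs : 0 < s) (hpn : s * ‖p‖ ≤ D / (16 * L) / 2)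
    (hv : ‖v‖ ≤ D + D / (16 * L) / 2) :
    Real.exp (4 * L / D ^ 2 * (2 * s * inner ℝ (clip g (D / (16 * L) / s) - p) v +
        2 * s ^ 2 * ‖clip g (D / (16 * L) / s) - p‖ ^ 2)) ≤
      1 + 8 * L * s / D ^ 2 * inner ℝ (g - p) v + 142 * L ^ 2 * s ^ 2 / D ^ 2 * ‖g - p‖ ^ 2 := by
  have hL0 : 0 < L := by linarith
  set B := D / (16 * L) with hBdef
  have hB0 : 0 < B := by positivity
  have hBL : 16 * L * B = D := by rw [hBdef]; field_simp
  have hBD : B ≤ D / 32 := by nlinarith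
  set l := B / s with hl
  have hl0 : 0 < l := by positivity
  have hsl : s * l = B := by rw [hl]; field_simp
  have hpl : ‖p‖ ≤ l / 2 := by
    rw [hl, div_div, mul_comm s 2, ← div_div, le_div_iff₀ hs]; linarith
  set c := clip g l with hc
  have h1 : ‖c - p‖ ≤ ‖g - p‖ := norm_clip_sub_le hl0.le (by linarith)
  have h2 : ‖c - g‖ ≤ ‖g - p‖ ^ 2 / (2 * l) := norm_clip_sub_self_le hl0 hpl
  have h3 : ‖c‖ ≤ l := norm_clip_le hl0.le
  have h4 : s * ‖c - p‖ ≤ 3 / 2 * B := by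
    have : ‖c - p‖ ≤ l + l / 2 := (norm_sub_le _ _).trans (by linarith)
    nlinarith
  set t := s * ‖c - p‖ with ht
  have ht0 : 0 ≤ t := by positivity
  have htn : t ≤ s * ‖g - p‖ := mul_le_mul_of_nonneg_left h1 hs.le
  have hin : |inner ℝ (c - p) v| ≤ ‖c - p‖ * (D + B / 2) :=
    (abs_real_inner_le_norm _ _).trans (mul_le_mul_of_nonneg_left hv (norm_nonneg _))
  set W := 2 * s * inner ℝ (c - p) v + 2 * s ^ 2 * ‖c - p‖ ^ 2 with hW
  have hWt : |W| ≤ 17 / 8 * D * t := by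
    have e1 : |2 * s * inner ℝ (c - p) v| ≤ 2 * t * (D + B / 2) := by
      rw [abs_mul, abs_of_pos (by positivity : 0 < 2 * s)]
      calc _ ≤ 2 * s * (‖c - p‖ * (D + B / 2)) := by gcongr
        _ = _ := by rw [ht]; ring
    have e2 : |2 * s ^ 2 * ‖c - p‖ ^ 2| = 2 * t ^ 2 := by
      rw [abs_of_nonneg (by positivity), ht]; ring
    have e3 := abs_add_le (2 * s * inner ℝ (c - p) v) (2 * s ^ 2 * ‖c - p‖ ^ 2)
    rw [e2] at e3
    have e4 : t * t ≤ 3 / 2 * B * t := mul_le_mul_of_nonneg_right h4 ht0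
    have e5 : B * t ≤ D / 32 * t := mul_le_mul_of_nonneg_right hBD ht0
    linarith
  set κ := 4 * L / D ^ 2 with hκ
  have hκ0 : 0 < κ := by positivity
  -- `κ` is small enough for the quadratic bound of the exponential
  have hκW : |κ * W| ≤ 1 := by
    rw [abs_mul, abs_of_pos hκ0]
    calc κ * |W| ≤ κ * (17 / 8 * D * (3 / 2 * B)) := by
          gcongr
          exact hWt.trans (by gcongr)
      _ = 51 / 64 := by rw [hκ, hBdef]; field_simp; norm_num
      _ ≤ 1 := by norm_num
  have hexp := Real.abs_exp_sub_one_sub_id_le hκW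
  have hexp' := (abs_le.1 hexp).2
  have hsq : (κ * W) ^ 2 ≤ 73 * L ^ 2 * s ^ 2 / D ^ 2 * ‖g - p‖ ^ 2 := by
    have e1 : |W| ≤ 17 / 8 * D * (s * ‖g - p‖) := hWt.trans (by gcongr)
    have e2 : W ^ 2 ≤ (17 / 8 * D * (s * ‖g - p‖)) ^ 2 := by
      rw [← sq_abs W]; gcongr
    calc (κ * W) ^ 2 = κ ^ 2 * W ^ 2 := by ring
      _ ≤ κ ^ 2 * (17 / 8 * D * (s * ‖g - p‖)) ^ 2 := by gcongr
      _ = (16 * (17 / 8) ^ 2) * (L ^ 2 * s ^ 2 / D ^ 2 * ‖g - p‖ ^ 2) := by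
        rw [hκ]; field_simp; ring
      _ ≤ 73 * (L ^ 2 * s ^ 2 / D ^ 2 * ‖g - p‖ ^ 2) := by gcongr; norm_num
      _ = _ := by ring
  have hlin : W ≤ 2 * s * inner ℝ (g - p) v + (16 * L + 5 / 2) * (s ^ 2 * ‖g - p‖ ^ 2) := by
    have e1 : inner ℝ (c - p) v = inner ℝ (g - p) v + inner ℝ (c - g) v := by
      rw [← inner_add_left]; congr 1; abel
    have e2 : inner ℝ (c - g) v ≤ ‖g - p‖ ^ 2 / (2 * l) * (D + B / 2) :=
      (real_inner_le_norm _ _).trans (mul_le_mul h2 hv (norm_nonneg _) (by positivity))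
    have e3 : 2 * s * (‖g - p‖ ^ 2 / (2 * l) * (D + B / 2)) =
        (16 * L + 1 / 2) * (s ^ 2 * ‖g - p‖ ^ 2) := by
      rw [hl, ← hBL]; field_simp
    have e4 : s ^ 2 * ‖c - p‖ ^ 2 ≤ s ^ 2 * ‖g - p‖ ^ 2 := by gcongr
    have e5 := mul_le_mul_of_nonneg_left e2 (by positivity : 0 ≤ 2 * s)
    have e6 : W = 2 * s * inner ℝ (g - p) v + 2 * s * inner ℝ (c - g) v +
        2 * (s ^ 2 * ‖c - p‖ ^ 2) := by rw [hW, e1]; ring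
    rw [e3] at e5
    rw [e6]
    linarith
  have hlin' : κ * W ≤ 8 * L * s / D ^ 2 * inner ℝ (g - p) v +
      69 * L ^ 2 * s ^ 2 / D ^ 2 * ‖g - p‖ ^ 2 := by
    calc κ * W ≤ κ * (2 * s * inner ℝ (g - p) v +
          (16 * L + 5 / 2) * (s ^ 2 * ‖g - p‖ ^ 2)) := by gcongr
      _ = 8 * L * s / D ^ 2 * inner ℝ (g - p) v +
          (64 * L ^ 2 + 10 * L) * (s ^ 2 / D ^ 2 * ‖g - p‖ ^ 2) := by rw [hκ]; ring
      _ ≤ 8 * L * s / D ^ 2 * inner ℝ (g - p) v +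
          (69 * L ^ 2) * (s ^ 2 / D ^ 2 * ‖g - p‖ ^ 2) := by gcongr; nlinarith
      _ = _ := by ring
  have : 69 * L ^ 2 * s ^ 2 / D ^ 2 * ‖g - p‖ ^ 2 + 73 * L ^ 2 * s ^ 2 / D ^ 2 * ‖g - p‖ ^ 2 =
    142 * L ^ 2 * s ^ 2 / D ^ 2 * ‖g - p‖ ^ 2 := by ring
  linarith

end Noise

/-! ### Independence of past and fresh samples -/

section Independence

variable {Ω Ξ ι : Type*} [MeasurableSpace Ξ]

/-- The `σ`-algebra generated by the samples with index in `S`. -/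
@[reducible] def sigmaOf (ξ : ι → Ω → Ξ) (S : Set ι) : MeasurableSpace Ω :=
  ⨆ j ∈ S, MeasurableSpace.comap (ξ j) inferInstance

theorem measurable_sigmaOf {ξ : ι → Ω → Ξ} {S : Set ι} {j : ι} (hj : j ∈ S) :
    Measurable[sigmaOf ξ S] (ξ j) :=
  Measurable.mono (comap_measurable (ξ j))
    (le_iSup₂_of_le (f := fun j (_ : j ∈ S) => MeasurableSpace.comap (ξ j) inferInstance)
      j hj le_rfl) le_rfl

variable [MeasurableSpace Ω] {P : Measure Ω}

theorem sigmaOf_le {ξ : ι → Ω → Ξ} (hξ : ∀ j, Measurable (ξ j)) (S : Set ι) :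
    sigmaOf ξ S ≤ ‹MeasurableSpace Ω› :=
  iSup₂_le fun j _ => (hξ j).comap_le

theorem indep_sigmaOf {ξ : ι → Ω → Ξ} (hξ : ∀ j, Measurable (ξ j)) (hi : iIndepFun ξ P)
    {S T : Set ι} (hST : Disjoint S T) : Indep (sigmaOf ξ S) (sigmaOf ξ T) P :=
  indep_iSup_of_disjoint (fun j => (hξ j).comap_le) hi hST

/-- Integrating a function of a quantity `X` of the past and a fresh `Y` amounts to integrating
over an independent copy of `Y` with `X` frozen. -/
theorem lintegral_mul_of_indep {Ω : Type*} {m₁ m₂ mΩ : MeasurableSpace Ω} {P : Measure Ω}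
    [IsProbabilityMeasure P] (h₁ : m₁ ≤ mΩ) (h₂ : m₂ ≤ mΩ) (hind : Indep m₁ m₂ P)
    {S T : Type*} [MeasurableSpace S] [MeasurableSpace T] {A : Ω → ENNReal} {X : Ω → S} {Y : Ω → T}
    (hA : Measurable[m₁] A) (hX : Measurable[m₁] X) (hY : Measurable[m₂] Y)
    {h : S → T → ENNReal} (hh : Measurable (Function.uncurry h)) :
    ∫⁻ ω, A ω * h (X ω) (Y ω) ∂P = ∫⁻ ω, A ω * ∫⁻ ω', h (X ω) (Y ω') ∂P ∂P := by
  have hA' : Measurable A := hA.mono h₁ le_rfl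
  have hX' : Measurable X := hX.mono h₁ le_rfl
  have hY' : Measurable Y := hY.mono h₂ le_rfl
  have hAX : Measurable[m₁] (fun ω => (A ω, X ω)) := hA.prodMk hX
  have hif : IndepFun (fun ω => (A ω, X ω)) Y P :=
    indep_of_indep_of_le_left (indep_of_indep_of_le_right hind hY.comap_le) hAX.comap_le
  have hmap := hif.map_prod_eq_prod_map_map (hA'.prodMk hX').aemeasurable hY'.aemeasurable
  have hF : Measurable (fun q : (ENNReal × S) × T => q.1.1 * h q.1.2 q.2) :=
    (measurable_fst.comp measurable_fst).mul
      (hh.comp ((measurable_snd.comp measurable_fst).prodMk measurable_snd))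
  have hF' := hF.lintegral_prod_right' (ν := P.map Y)
  have e1 : ∫⁻ ω, A ω * h (X ω) (Y ω) ∂P =
      ∫⁻ q, q.1.1 * h q.1.2 q.2 ∂(P.map (fun ω => ((A ω, X ω), Y ω))) :=
    (lintegral_map (f := fun q : (ENNReal × S) × T => q.1.1 * h q.1.2 q.2) hF
      ((hA'.prodMk hX').prodMk hY')).symm
  have : IsProbabilityMeasure (P.map Y) := Measure.isProbabilityMeasure_map hY'.aemeasurable
  have e2 : ∫⁻ q, q.1.1 * h q.1.2 q.2 ∂((P.map (fun ω => (A ω, X ω))).prod (P.map Y)) =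
      ∫⁻ p, ∫⁻ t, p.1 * h p.2 t ∂(P.map Y) ∂(P.map (fun ω => (A ω, X ω))) :=
    lintegral_prod _ hF.aemeasurable
  have e3 : ∫⁻ p, ∫⁻ t, p.1 * h p.2 t ∂(P.map Y) ∂(P.map (fun ω => (A ω, X ω))) =
      ∫⁻ ω, ∫⁻ t, A ω * h (X ω) t ∂(P.map Y) ∂P :=
    lintegral_map (f := fun p : ENNReal × S => ∫⁻ t, p.1 * h p.2 t ∂(P.map Y)) hF'
      (hA'.prodMk hX')
  rw [e1, hmap, e2, e3]
  refine lintegral_congr fun ω => ?_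
  have hh' : Measurable (h (X ω)) := hh.comp measurable_prodMk_left
  rw [lintegral_const_mul _ hh', lintegral_map hh' hY']

end Independence

/-! ### The mini-batch -/

section MiniBatch

variable {n : ℕ} {f : EuclideanSpace ℝ (Fin n) → ℝ} {Ξ Ω : Type*}
  {G : EuclideanSpace ℝ (Fin n) → Ξ → EuclideanSpace ℝ (Fin n)} {σ : ℝ} {ζ : ℕ → Ω → Ξ}

theorem miniBatch_sub {m : ℕ} (hm : 0 < m) (s : ℕ → Ξ) (x p : EuclideanSpace ℝ (Fin n)) :
    miniBatch G m s x - p = (m : ℝ)⁻¹ • ∑ i ∈ Finset.range m, (G x (s i) - p) := by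
  have : (m : ℝ) ≠ 0 := by positivity
  rw [miniBatch, Finset.sum_sub_distrib, smul_sub, Finset.sum_const, Finset.card_range,
    ← Nat.cast_smul_eq_nsmul ℝ, inv_smul_smul₀ this]

variable [MeasurableSpace Ξ] [MeasurableSpace Ω] {D : Measure Ξ} {P : Measure Ω}

theorem IsStochasticGradient.measurable_right (hG : IsStochasticGradient f G D σ)
    (x : EuclideanSpace ℝ (Fin n)) : Measurable (G x) :=
  hG.measurable.comp measurable_prodMk_left

theorem measurable_miniBatch {Ω' : Type*} [MeasurableSpace Ω']
    (hG : Measurable (Function.uncurry G))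
    (m : ℕ) {s : Ω' → ℕ → Ξ} {x : Ω' → EuclideanSpace ℝ (Fin n)} (hx : Measurable x)
    (hs : ∀ i, Measurable fun ω => s ω i) :
    Measurable fun ω => miniBatch G m (s ω) (x ω) := by
  unfold miniBatch
  have h : Measurable fun ω => ∑ i ∈ Finset.range m, G (x ω) (s ω i) :=
    Finset.measurable_fun_sum _ fun i _ => hG.comp (hx.prodMk (hs i))
  exact h.const_smul ((m : ℝ)⁻¹)

theorem IsStochasticGradient.memLp_sub [IsFiniteMeasure D] (hG : IsStochasticGradient f G D σ)
    (x : EuclideanSpace ℝ (Fin n)) : MemLp (fun s => G x s - gradient f x) 2 D :=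
  (memLp_two_iff_integrable_sq_norm
    ((hG.measurable_right x).sub_const _).aestronglyMeasurable).2 (hG.integrable_sq x)

theorem IsStochasticGradient.integral_sq_sample (hG : IsStochasticGradient f G D σ)
    (hζ : ∀ i, Measurable (ζ i)) (hD : ∀ i, P.map (ζ i) = D) (x : EuclideanSpace ℝ (Fin n))
    (i : ℕ) : ∫ ω, ‖G x (ζ i ω) - gradient f x‖ ^ 2 ∂P ≤ σ ^ 2 := by
  have h2 := integral_map (hζ i).aemeasurable
    (f := fun s => ‖G x s - gradient f x‖ ^ 2) (μ := P)
    (((hG.measurable_right x).sub_const _).norm.pow_const 2).aestronglyMeasurable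
  rw [← h2, hD i]
  exact hG.variance_le x

variable [IsProbabilityMeasure P]

theorem IsStochasticGradient.memLp_sample (hG : IsStochasticGradient f G D σ)
    (hζ : ∀ i, Measurable (ζ i)) (hD : ∀ i, P.map (ζ i) = D) (x : EuclideanSpace ℝ (Fin n))
    (i : ℕ) : MemLp (fun ω => G x (ζ i ω) - gradient f x) 2 P := by
  have : IsProbabilityMeasure D := hD 0 ▸ Measure.isProbabilityMeasure_map (hζ 0).aemeasurable
  have h := hG.memLp_sub x
  rw [← hD i] at h
  exact h.comp_of_map (hζ i).aemeasurable

theorem IsStochasticGradient.integral_sample (hG : IsStochasticGradient f G D σ)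
    (hζ : ∀ i, Measurable (ζ i)) (hD : ∀ i, P.map (ζ i) = D) (x : EuclideanSpace ℝ (Fin n))
    (i : ℕ) : ∫ ω, (G x (ζ i ω) - gradient f x) ∂P = 0 := by
  have : IsProbabilityMeasure D := hD 0 ▸ Measure.isProbabilityMeasure_map (hζ 0).aemeasurable
  have h := hG.integrable x
  have h2 := integral_map (hζ i).aemeasurable
    (f := fun s => G x s - gradient f x) (μ := P)
    ((hG.measurable_right x).sub_const _).aestronglyMeasurable
  rw [← h2, hD i, integral_sub h (integrable_const _), hG.unbiased]
  simp

theorem integral_norm_sq_sum_of_indep {X : ℕ → Ω → EuclideanSpace ℝ (Fin n)}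
    (hX : ∀ i, MemLp (X i) 2 P) (h0 : ∀ i, ∫ ω, X i ω ∂P = 0)
    (hi : ∀ i j, i ≠ j → IndepFun (X i) (X j) P) (m : ℕ) :
    ∫ ω, ‖∑ i ∈ Finset.range m, X i ω‖ ^ 2 ∂P = ∑ i ∈ Finset.range m, ∫ ω, ‖X i ω‖ ^ 2 ∂P := by
  have hsq (i : ℕ) : Integrable (fun ω => ‖X i ω‖ ^ 2) P :=
    (memLp_two_iff_integrable_sq_norm (hX i).1).1 (hX i)
  have hint (i j : ℕ) : Integrable (fun ω => inner ℝ (X i ω) (X j ω)) P := by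
    refine ((hsq i).add (hsq j)).mono' ((hX i).1.inner (hX j).1) (Filter.Eventually.of_forall ?_)
    intro ω
    have h1 := abs_real_inner_le_norm (X i ω) (X j ω)
    simp only [Real.norm_eq_abs, Pi.add_apply]
    nlinarith [sq_nonneg (‖X i ω‖ - ‖X j ω‖), sq_nonneg ‖X i ω‖, sq_nonneg ‖X j ω‖]
  have hL1 (i : ℕ) : Integrable (X i) P := (hX i).integrable (by norm_num)
  have e1 (ω : Ω) : ‖∑ i ∈ Finset.range m, X i ω‖ ^ 2 =
      ∑ i ∈ Finset.range m, ∑ j ∈ Finset.range m, inner ℝ (X i ω) (X j ω) := by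
    rw [← real_inner_self_eq_norm_sq, sum_inner]
    simp_rw [inner_sum]
  simp_rw [e1]
  rw [integral_finsetSum _ fun i _ => integrable_finsetSum _ fun j _ => hint i j]
  refine Finset.sum_congr rfl fun i hi' => ?_
  rw [integral_finsetSum _ fun j _ => hint i j, Finset.sum_eq_single_of_mem i hi']
  · simp_rw [real_inner_self_eq_norm_sq]
  · intro j _ hj
    have := (hi i j hj.symm).integral_bilin (hL1 i) (hL1 j) (innerSL ℝ)
    rw [h0, map_zero] at this
    exact this

/-- The error of the mini-batch is centered, and its variance is at most `σ² / m`. -/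
theorem IsStochasticGradient.miniBatch_moments (hG : IsStochasticGradient f G D σ)
    (hζ : ∀ i, Measurable (ζ i)) (hD : ∀ i, P.map (ζ i) = D) (hi : iIndepFun ζ P)
    (x : EuclideanSpace ℝ (Fin n)) {m : ℕ} (hm : 0 < m) :
    Integrable (fun ω => miniBatch G m (fun i => ζ i ω) x - gradient f x) P ∧
    Integrable (fun ω => ‖miniBatch G m (fun i => ζ i ω) x - gradient f x‖ ^ 2) P ∧
    ∫ ω, (miniBatch G m (fun i => ζ i ω) x - gradient f x) ∂P = 0 ∧
    ∫ ω, ‖miniBatch G m (fun i => ζ i ω) x - gradient f x‖ ^ 2 ∂P ≤ σ ^ 2 / m := by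
  have hX := hG.memLp_sample hζ hD x
  have h0 := hG.integral_sample hζ hD x
  have hmeas : Measurable (fun s => G x s - gradient f x) := (hG.measurable_right x).sub_const _
  have hind : ∀ i j, i ≠ j →
      IndepFun (fun ω => G x (ζ i ω) - gradient f x) (fun ω => G x (ζ j ω) - gradient f x) P :=
    fun i j hij => (hi.indepFun hij).comp hmeas hmeas
  have hsum := integral_norm_sq_sum_of_indep hX h0 hind m
  have hm' : (0 : ℝ) < m := by exact_mod_cast hm
  simp_rw [miniBatch_sub hm]
  have hS : MemLp (fun ω => ∑ i ∈ Finset.range m, (G x (ζ i ω) - gradient f x)) 2 P :=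
    memLp_finsetSum _ fun i _ => hX i
  have hS' := hS.const_smul ((m : ℝ)⁻¹)
  refine ⟨hS'.integrable (by norm_num), (memLp_two_iff_integrable_sq_norm hS'.1).1 hS', ?_, ?_⟩
  · rw [integral_smul, integral_finsetSum _ fun i _ => (hX i).integrable (by norm_num)]
    simp [h0]
  · simp_rw [norm_smul, mul_pow]
    rw [integral_const_mul, hsum]
    have h1 : ∑ i ∈ Finset.range m, ∫ ω, ‖G x (ζ i ω) - gradient f x‖ ^ 2 ∂P ≤ m * σ ^ 2 := by
      refine (Finset.sum_le_sum fun i _ => hG.integral_sq_sample hζ hD x i).trans ?_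
      simp
    calc _ ≤ ‖(m : ℝ)⁻¹‖ ^ 2 * (m * σ ^ 2) := by gcongr
      _ = σ ^ 2 / m := by
        rw [norm_inv, Real.norm_eq_abs, abs_of_pos hm']; field_simp

end MiniBatch

/-! ### Measurability of the iterates -/

section Measurability

variable {n : ℕ} {f : EuclideanSpace ℝ (Fin n) → ℝ} {Ξ Ω : Type*} [MeasurableSpace Ξ]
  [MeasurableSpace Ω] {G : EuclideanSpace ℝ (Fin n) → Ξ → EuclideanSpace ℝ (Fin n)}
  {ν α B : ℝ} {k : ℕ}

theorem measurable_gradient (f : EuclideanSpace ℝ (Fin n) → ℝ) : Measurable (gradient f) :=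
  (InnerProductSpace.toDual ℝ (EuclideanSpace ℝ (Fin n))).symm.continuous.measurable.comp
    (measurable_fderiv ℝ f)

theorem measurable_clip {v : Ω → EuclideanSpace ℝ (Fin n)} (hv : Measurable v) (l : ℝ) :
    Measurable fun ω => clip (v ω) l :=
  (measurable_const.min (measurable_const.div hv.norm)).smul hv

theorem measurable_extrapolation {y z : Ω → EuclideanSpace ℝ (Fin n)} (hy : Measurable y)
    (hz : Measurable z) : Measurable fun ω => extrapolation ν α k (y ω) (z ω) :=
  ((hy.const_smul (stepSum α ν k)).add (hz.const_smul (stepSize α ν (k + 1)))).const_smul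
    (stepSum α ν (k + 1))⁻¹

theorem measurable_step (hG : Measurable (Function.uncurry G)) (m : ℕ)
    {S : Ω → State (EuclideanSpace ℝ (Fin n))} {s : Ω → ℕ → Ξ}
    (hy : Measurable fun ω => (S ω).y) (hz : Measurable fun ω => (S ω).z)
    (hs : ∀ i, Measurable fun ω => s ω i) :
    (Measurable fun ω => (step G ν α B k m (s ω) (S ω)).y) ∧
      Measurable fun ω => (step G ν α B k m (s ω) (S ω)).z := by
  have hz' : Measurable fun ω => (step G ν α B k m (s ω) (S ω)).z :=
    hz.sub ((measurable_clip (measurable_miniBatch hG m (measurable_extrapolation hy hz) hs)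
      (B / stepSize α ν (k + 1))).const_smul (stepSize α ν (k + 1)))
  exact ⟨measurable_extrapolation hy hz', hz'⟩

theorem measurable_run (hG : Measurable (Function.uncurry G)) (m : ℕ → ℕ)
    {x0 : Ω → EuclideanSpace ℝ (Fin n)} (hx0 : Measurable x0) {s : Ω → ℕ → ℕ → Ξ}
    (hs : ∀ j < k, ∀ i, Measurable fun ω => s ω j i) :
    (Measurable fun ω => (run G ν (x0 ω) α B m (s ω) k).y) ∧
      Measurable fun ω => (run G ν (x0 ω) α B m (s ω) k).z := by
  induction k with
  | zero => exact ⟨hx0, hx0⟩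
  | succ k ih =>
    obtain ⟨hy, hz⟩ := ih fun j hj => hs j (hj.trans (Nat.lt_succ_self k))
    exact measurable_step hG (m k) hy hz (hs k (Nat.lt_succ_self k))

theorem measurable_noiseTerm (hG : Measurable (Function.uncurry G))
    (xs : EuclideanSpace ℝ (Fin n)) (m : ℕ) {y z : Ω → EuclideanSpace ℝ (Fin n)} {s : Ω → ℕ → Ξ}
    (hy : Measurable y) (hz : Measurable z) (hs : ∀ i, Measurable fun ω => s ω i) :
    Measurable fun ω => noiseTerm f G xs ν α B k m (s ω) (y ω) (z ω) := by
  have hx := measurable_extrapolation (ν := ν) (α := α) (k := k) hy hz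
  have hp := (measurable_gradient f).comp hx
  have hθ := (measurable_clip (measurable_miniBatch hG m hx hs) (B / stepSize α ν (k + 1))).sub hp
  exact ((hθ.inner ((measurable_const.sub hz).add
    (hp.const_smul (stepSize α ν (k + 1))))).const_mul _).add ((hθ.norm.pow_const 2).const_mul _)

theorem measurable_potential (hf : Continuous f) (xs : EuclideanSpace ℝ (Fin n)) (ε : ℝ)
    {y z : Ω → EuclideanSpace ℝ (Fin n)} (hy : Measurable y) (hz : Measurable z) :
    Measurable fun ω => potential f xs ν α ε k (y ω) (z ω) :=
  (((hz.sub_const xs).norm.pow_const 2).add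
    (((hf.measurable.comp hy).sub_const (f xs)).const_mul _)).sub_const _

theorem measurableSet_isGood (hf : Continuous f) (xs : EuclideanSpace ℝ (Fin n)) (D : ℝ)
    {y z : Ω → EuclideanSpace ℝ (Fin n)} (hy : Measurable y) (hz : Measurable z) :
    MeasurableSet {ω | IsGood f xs ν α D k (y ω) (z ω)} := by
  have h : {ω | IsGood f xs ν α D k (y ω) (z ω)} = {ω | ‖y ω - xs‖ ≤ D} ∩ {ω | ‖z ω - xs‖ ≤ D} ∩
      {ω | 2 * stepSum α ν k * (f (y ω) - f xs) ≤ D ^ 2} := by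
    ext ω
    exact ⟨fun h => ⟨⟨h.1, h.2⟩, h.3⟩, fun h => ⟨h.1.1, h.1.2, h.2⟩⟩
  rw [h]
  exact ((measurableSet_le (hy.sub_const xs).norm measurable_const).inter
    (measurableSet_le (hz.sub_const xs).norm measurable_const)).inter
    (measurableSet_le (((hf.measurable.comp hy).sub_const (f xs)).const_mul _) measurable_const)

end Measurability

/-! ### The failure probability of one run -/

section Run

variable {n : ℕ} {f : EuclideanSpace ℝ (Fin n) → ℝ} {μ ν M R ε L α σ : ℝ} {N k : ℕ}
  {xs y z : EuclideanSpace ℝ (Fin n)} {Ξ Ω : Type*} [MeasurableSpace Ξ] [MeasurableSpace Ω]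
  {D : Measure Ξ} {P : Measure Ω} [IsProbabilityMeasure P]
  {G : EuclideanSpace ℝ (Fin n) → Ξ → EuclideanSpace ℝ (Fin n)}

/-- The exponential moment of the noise of one iteration, from a fixed good state. -/
theorem RunBounds.lintegral_exp_noiseTerm_le (hp : RunBounds ν M R ε L α N)
    (hf : IsStronglyConvex f μ) (hμ : 0 ≤ μ) (hmin : ∀ x, f xs ≤ f x)
    (hQ : HasHolderGradientOn f ν M (Metric.closedBall xs (3 * R))) (hk : k < N)
    (hG : IsStochasticGradient f G D σ) {ζ : ℕ → Ω → Ξ}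
    (hζ : ∀ i, Measurable (ζ i)) (hD : ∀ i, P.map (ζ i) = D) (hi : iIndepFun ζ P)
    {m : ℕ} (hm : 0 < m)
    (hmσ : stepSize α ν (k + 1) ^ 2 * (σ ^ 2 / m) ≤ (constC * R) ^ 2 / (20736 * N * L))
    (hg : IsGood f xs ν α (constC * R) k y z) :
    ∫⁻ ω, ENNReal.ofReal (Real.exp (4 * L / (constC * R) ^ 2 *
        noiseTerm f G xs ν α (constC * R / (16 * L)) k m (fun i => ζ i ω) y z)) ∂P ≤
      ENNReal.ofReal (Real.exp (L / (100 * N))) := by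
  have hL := hp.two_le
  have hL0 : 0 < L := by linarith
  have hs := stepSize_pos (ν := ν) hp.alpha_pos k
  have hR : 0 < constC * R := mul_pos constC_pos hp.R_pos
  have hN : (0 : ℝ) < N := by exact_mod_cast hp.N_pos
  have hpn := hp.mul_norm_gradient_le hf hμ hmin hQ hk hg
  obtain ⟨hI, hI2, h0, hv⟩ := hG.miniBatch_moments hζ hD hi (extrapolation ν α k y z) hm
  set x := extrapolation ν α k y z with hx
  set E := constC * R
  set s := stepSize α ν (k + 1)
  set v := xs - z + s • gradient f x with hvdef
  have hvn : ‖v‖ ≤ E + E / (16 * L) / 2 := by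
    refine (norm_add_le _ _).trans (add_le_add ?_ ?_)
    · rw [norm_sub_rev]; exact hg.norm_z
    · rwa [norm_smul, Real.norm_eq_abs, abs_of_pos hs]
  have hpt (ω : Ω) := exp_noise_le (g := miniBatch G m (fun i => ζ i ω) x) hR hL hs hpn hvn
  have hlin : Integrable (fun ω => inner ℝ (miniBatch G m (fun i => ζ i ω) x - gradient f x) v) P :=
    hI.inner_const v
  have hlin0 : ∫ ω, inner ℝ (miniBatch G m (fun i => ζ i ω) x - gradient f x) v ∂P = 0 := by
    simp_rw [real_inner_comm v]
    rw [integral_inner hI, h0, inner_zero_right]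
  have hint₁ : Integrable (fun ω => 1 +
      8 * L * s / E ^ 2 * inner ℝ (miniBatch G m (fun i => ζ i ω) x - gradient f x) v) P :=
    (integrable_const _).add (hlin.const_mul _)
  have hint : Integrable (fun ω => 1 +
      8 * L * s / E ^ 2 * inner ℝ (miniBatch G m (fun i => ζ i ω) x - gradient f x) v +
      142 * L ^ 2 * s ^ 2 / E ^ 2 * ‖miniBatch G m (fun i => ζ i ω) x - gradient f x‖ ^ 2) P :=
    hint₁.add (hI2.const_mul _)
  calc _ ≤ ∫⁻ ω, ENNReal.ofReal (1 +
      8 * L * s / E ^ 2 * inner ℝ (miniBatch G m (fun i => ζ i ω) x - gradient f x) v +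
      142 * L ^ 2 * s ^ 2 / E ^ 2 * ‖miniBatch G m (fun i => ζ i ω) x - gradient f x‖ ^ 2) ∂P :=
        lintegral_mono fun ω => ENNReal.ofReal_le_ofReal (hpt ω)
    _ = ENNReal.ofReal (∫ ω, (1 +
      8 * L * s / E ^ 2 * inner ℝ (miniBatch G m (fun i => ζ i ω) x - gradient f x) v +
      142 * L ^ 2 * s ^ 2 / E ^ 2 * ‖miniBatch G m (fun i => ζ i ω) x - gradient f x‖ ^ 2) ∂P) :=
        (ofReal_integral_eq_lintegral_ofReal hint
          (Filter.Eventually.of_forall fun ω => (Real.exp_pos _).le.trans (hpt ω))).symm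
    _ ≤ _ := by
      apply ENNReal.ofReal_le_ofReal
      rw [integral_add hint₁ (hI2.const_mul _),
        integral_add (integrable_const _) (hlin.const_mul _), integral_const_mul,
        integral_const_mul, hlin0]
      have h1 : 142 * L ^ 2 * s ^ 2 / E ^ 2 *
          ∫ ω, ‖miniBatch G m (fun i => ζ i ω) x - gradient f x‖ ^ 2 ∂P ≤ L / (100 * N) := by
        calc _ ≤ 142 * L ^ 2 * s ^ 2 / E ^ 2 * (σ ^ 2 / m) := by gcongr
          _ = 142 * L ^ 2 / E ^ 2 * (s ^ 2 * (σ ^ 2 / m)) := by ring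
          _ ≤ 142 * L ^ 2 / E ^ 2 * (E ^ 2 / (20736 * N * L)) := by gcongr
          _ = 142 / 20736 * (L / N) := by field_simp
          _ ≤ 1 / 100 * (L / N) := mul_le_mul_of_nonneg_right (by norm_num) (by positivity)
          _ = L / (100 * N) := by ring
      simp only [integral_const, probReal_univ, smul_eq_mul, mul_one, mul_zero, add_zero]
      linarith [Real.add_one_le_exp (L / (100 * N))]

/-- A run that leaves the good states has a large potential. The distance of `y` to the minimizer
is controlled by the one of `z`, hence cannot be the first to exceed its bound. -/
theorem RunBounds.le_potential_of_not_isGood (hp : RunBounds ν M R ε L α N)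
    (hmin : ∀ x, f xs ≤ f x) (hk : k ≤ N) (hy : ‖z - xs‖ ≤ constC * R → ‖y - xs‖ ≤ constC * R)
    (hg : ¬ IsGood f xs ν α (constC * R) k y z) :
    33 / 10 * R ^ 2 ≤ potential f xs ν α ε k y z := by
  have hR : 0 < constC * R := mul_pos constC_pos hp.R_pos
  have hDR : (constC * R) ^ 2 = 7 * R ^ 2 := by rw [mul_pow, constC_sq]
  have hA := stepSum_nonneg (ν := ν) hp.alpha_pos k
  have h1 : stepSum α ν k * ε ≤ 73 / 10 * R ^ 2 :=
    (mul_le_mul_of_nonneg_right (stepSum_mono hp.alpha_pos hk) hp.eps_pos.le).trans hp.upper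
  have h2 : 0 ≤ 2 * stepSum α ν k * (f y - f xs) :=
    mul_nonneg (by positivity) (sub_nonneg.2 (hmin y))
  have h3 : 7 * R ^ 2 ≤ ‖z - xs‖ ^ 2 + 2 * stepSum α ν k * (f y - f xs) := by
    rw [← hDR]
    by_cases hz : ‖z - xs‖ ≤ constC * R
    · have h4 : ¬ 2 * stepSum α ν k * (f y - f xs) ≤ (constC * R) ^ 2 :=
        fun h => hg ⟨hy hz, hz, h⟩
      have := sq_nonneg ‖z - xs‖
      linarith
    · have h4 : (constC * R) ^ 2 ≤ ‖z - xs‖ ^ 2 :=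
        pow_le_pow_left₀ hR.le (not_le.1 hz).le 2
      linarith
  unfold potential
  nlinarith [sq_nonneg R]

theorem RunBounds.le_potential_of_lt (hp : RunBounds ν M R ε L α N) (h : ε < f y - f xs) :
    33 / 10 * R ^ 2 ≤ potential f xs ν α ε N y z := by
  have hA := stepSum_nonneg (ν := ν) hp.alpha_pos N
  have h1 := hp.lower
  have h2 : stepSum α ν N * ε ≤ stepSum α ν N * (f y - f xs) :=
    mul_le_mul_of_nonneg_left h.le hA
  unfold potential
  nlinarith [sq_nonneg ‖z - xs‖, sq_nonneg R]

open Classical in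
/-- One run misses the accuracy `ε` with probability at most `exp (-L)`. The exponential of the
potential, frozen at a fixed level once the run leaves the good states, is almost a
supermartingale, and Markov's inequality applies. -/
theorem RunBounds.measure_lt_le (hp : RunBounds ν M R ε L α N)
    (hf : IsStronglyConvex f μ) (hμ : 0 ≤ μ) (hmin : ∀ x, f xs ≤ f x)
    (hQ : HasHolderGradientOn f ν M (Metric.closedBall xs (3 * R)))
    (hG : IsStochasticGradient f G D σ) {ζ : ℕ × ℕ → Ω → Ξ}
    (hζ : ∀ j, Measurable (ζ j)) (hD : ∀ j, P.map (ζ j) = D) (hi : iIndepFun ζ P)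
    {m : ℕ → ℕ} (hm : ∀ k < N, 0 < m k)
    (hmσ : ∀ k < N, stepSize α ν (k + 1) ^ 2 * (σ ^ 2 / m k) ≤
      (constC * R) ^ 2 / (20736 * N * L))
    {x0 : EuclideanSpace ℝ (Fin n)} (hx0 : ‖x0 - xs‖ ≤ R) :
    P {ω | ε < f (run G ν x0 α (constC * R / (16 * L)) m (fun k i => ζ (k, i) ω) N).y - f xs} ≤
      ENNReal.ofReal (Real.exp (-L)) := by
  have hα := hp.alpha_pos
  have hL := hp.two_le
  have hL0 : 0 < L := by linarith
  have hR := hp.R_pos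
  have hE : 0 < constC * R := mul_pos constC_pos hR
  have hDR : (constC * R) ^ 2 = 7 * R ^ 2 := by rw [mul_pow, constC_sq]
  have hN : (0 : ℝ) < N := by exact_mod_cast hp.N_pos
  have hfc : Continuous f := hf.differentiable.continuous
  set B := constC * R / (16 * L)
  set κ := 4 * L / (constC * R) ^ 2 with hκ
  have hκ0 : 0 < κ := by positivity
  set S : ℕ → Ω → State (EuclideanSpace ℝ (Fin n)) :=
    fun k ω => run G ν x0 α B m (fun k i => ζ (k, i) ω) k with hS
  set Good : ℕ → Ω → Prop :=
    fun k ω => ∀ j ≤ k, IsGood f xs ν α (constC * R) j (S j ω).y (S j ω).z with hGood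
  set V : ℕ → Ω → ENNReal := fun k ω => if Good k ω then
      ENNReal.ofReal (Real.exp (κ * potential f xs ν α ε k (S k ω).y (S k ω).z))
    else ENNReal.ofReal (Real.exp (κ * (33 / 10 * R ^ 2))) with hV
  -- measurability with respect to the past
  have hSm (j k : ℕ) (hjk : j ≤ k) :
      Measurable[sigmaOf ζ {p | p.1 < k}] (fun ω => (S j ω).y) ∧
        Measurable[sigmaOf ζ {p | p.1 < k}] (fun ω => (S j ω).z) :=
    @measurable_run n Ξ Ω _ (sigmaOf ζ {p | p.1 < k}) G ν α B j hG.measurable m (fun _ => x0)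
      (@measurable_const _ _ _ (sigmaOf ζ {p | p.1 < k}) x0) (fun ω k i => ζ (k, i) ω)
      (fun l hl i => measurable_sigmaOf (by exact lt_of_lt_of_le hl hjk))
  have hGm (k : ℕ) : MeasurableSet[sigmaOf ζ {p | p.1 < k}] {ω | Good k ω} := by
    have : {ω | Good k ω} = ⋂ j, ⋂ (_ : j ≤ k),
        {ω | IsGood f xs ν α (constC * R) j (S j ω).y (S j ω).z} := by
      ext ω; simp [hGood]
    rw [this]
    exact MeasurableSet.iInter fun j => MeasurableSet.iInter fun hj =>
      @measurableSet_isGood n f Ω (sigmaOf ζ {p | p.1 < k}) ν α j hfc xs (constC * R) _ _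
        (hSm j k hj).1 (hSm j k hj).2
  have hle (k : ℕ) := sigmaOf_le hζ {p : ℕ × ℕ | p.1 < k}
  have hGm' (k : ℕ) : MeasurableSet {ω | Good k ω} := hle k _ (hGm k)
  -- the supermartingale property
  have hstep (k : ℕ) (hk : k < N) :
      ∫⁻ ω, V (k + 1) ω ∂P ≤ ENNReal.ofReal (Real.exp (L / (100 * N))) * ∫⁻ ω, V k ω ∂P := by
    set h : EuclideanSpace ℝ (Fin n) × EuclideanSpace ℝ (Fin n) → (ℕ → Ξ) → ENNReal :=
      fun q s => ENNReal.ofReal (Real.exp (κ * (potential f xs ν α ε k q.1 q.2 +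
        noiseTerm f G xs ν α B k (m k) s q.1 q.2))) with hh
    have hhm : Measurable (Function.uncurry h) := by
      refine ENNReal.measurable_ofReal.comp (Real.measurable_exp.comp (Measurable.const_mul ?_ κ))
      exact (measurable_potential hfc xs ε (measurable_fst.comp measurable_fst)
        (measurable_snd.comp measurable_fst)).add
        (measurable_noiseTerm (s := fun p : (EuclideanSpace ℝ (Fin n) × EuclideanSpace ℝ (Fin n)) ×
          (ℕ → Ξ) => p.2) hG.measurable xs (m k) (measurable_fst.comp measurable_fst)
          (measurable_snd.comp measurable_fst) fun i => (measurable_pi_apply i).comp measurable_snd)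
    -- the value on the good event, where the fresh noise matters, and on its complement
    set A : Ω → ENNReal := {ω | Good k ω}.indicator 1 with hA
    set A' : Ω → ENNReal := {ω | Good k ω}ᶜ.indicator
      fun _ => ENNReal.ofReal (Real.exp (κ * (33 / 10 * R ^ 2))) with hA'
    have hA'm : Measurable A' := measurable_const.indicator (hGm' k).compl
    have h1 (ω : Ω) : V (k + 1) ω ≤
        A ω * h ((S k ω).y, (S k ω).z) (fun i => ζ (k, i) ω) + A' ω := by
      by_cases hgk : Good k ω
      · have hgk' := hgk k le_rfl
        have hps := hp.potential_step hf hμ hQ G (m k) (fun i => ζ (k, i) ω) hgk'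
        have hA1 : A ω = 1 := Set.indicator_of_mem (s := {ω | Good k ω}) hgk _
        rw [hA1, one_mul]
        refine le_trans ?_ le_self_add
        simp only [hV, hh]
        split_ifs with hgk1
        · exact ENNReal.ofReal_le_ofReal (Real.exp_le_exp.2 (mul_le_mul_of_nonneg_left hps hκ0.le))
        · refine ENNReal.ofReal_le_ofReal (Real.exp_le_exp.2
            (mul_le_mul_of_nonneg_left (le_trans ?_ hps) hκ0.le))
          refine hp.le_potential_of_not_isGood hmin hk
            (fun hz => norm_extrapolation_sub_le hα hgk'.norm_y hz) fun hbad => hgk1 ?_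
          intro j hj
          rcases Nat.le_succ_iff.1 hj with hj | rfl
          · exact hgk j hj
          · exact hbad
      · have hgk1 : ¬ Good (k + 1) ω := fun h' => hgk fun j hj => h' j (hj.trans (Nat.le_succ k))
        have hA1 : A' ω = ENNReal.ofReal (Real.exp (κ * (33 / 10 * R ^ 2))) :=
          Set.indicator_of_mem (s := {ω | Good k ω}ᶜ) hgk _
        simp only [hV, if_neg hgk1]
        rw [hA1]
        exact le_add_self
    have h2 : ∫⁻ ω, A ω * h ((S k ω).y, (S k ω).z) (fun i => ζ (k, i) ω) ∂P =
        ∫⁻ ω, A ω * ∫⁻ ω', h ((S k ω).y, (S k ω).z) (fun i => ζ (k, i) ω') ∂P ∂P := by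
      refine lintegral_mul_of_indep (hle k) (sigmaOf_le hζ {p | p.1 = k})
        (indep_sigmaOf hζ hi ?_) (X := fun ω => ((S k ω).y, (S k ω).z))
        (Y := fun ω i => ζ (k, i) ω) ?_ ?_ ?_ hhm
      · exact Set.disjoint_left.2 fun p hp1 hp2 => (ne_of_lt hp1) hp2
      · exact Measurable.indicator (@measurable_const _ _ _ (sigmaOf ζ {p | p.1 < k}) 1) (hGm k)
      · exact (hSm k k le_rfl).1.prodMk (hSm k k le_rfl).2
      · exact @measurable_pi_lambda _ _ _ (sigmaOf ζ {p | p.1 = k}) _ _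
          fun i => measurable_sigmaOf (by exact rfl)
    have h3 (ω : Ω) : A ω * ∫⁻ ω', h ((S k ω).y, (S k ω).z) (fun i => ζ (k, i) ω') ∂P + A' ω ≤
        ENNReal.ofReal (Real.exp (L / (100 * N))) * V k ω := by
      by_cases hgk : Good k ω
      · have hA1 : A ω = 1 := Set.indicator_of_mem (s := {ω | Good k ω}) hgk _
        have hA2 : A' ω = 0 := Set.indicator_of_notMem (s := {ω | Good k ω}ᶜ) (fun h' => h' hgk) _
        rw [hA1, hA2, one_mul, add_zero]
        simp only [hV, if_pos hgk, hh]
        have hno := hp.lintegral_exp_noiseTerm_le hf hμ hmin hQ hk hG (ζ := fun i => ζ (k, i))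
          (fun i => hζ _) (fun i => hD _)
          (hi.precomp (g := fun i => (k, i)) fun i j hij => (Prod.ext_iff.1 hij).2)
          (hm k hk) (hmσ k hk) (hgk k le_rfl)
        simp_rw [mul_add, Real.exp_add, ENNReal.ofReal_mul (Real.exp_pos _).le]
        rw [lintegral_const_mul' _ _ ENNReal.ofReal_ne_top, mul_comm]
        gcongr
      · have hA1 : A ω = 0 := Set.indicator_of_notMem (s := {ω | Good k ω}) hgk _
        have hA2 : A' ω = ENNReal.ofReal (Real.exp (κ * (33 / 10 * R ^ 2))) :=
          Set.indicator_of_mem (s := {ω | Good k ω}ᶜ) hgk _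
        rw [hA1, hA2, zero_mul, zero_add]
        simp only [hV, if_neg hgk]
        refine le_mul_of_one_le_left zero_le ?_
        rw [ENNReal.one_le_ofReal]
        exact Real.one_le_exp (by positivity)
    calc ∫⁻ ω, V (k + 1) ω ∂P
        ≤ ∫⁻ ω, A ω * h ((S k ω).y, (S k ω).z) (fun i => ζ (k, i) ω) + A' ω ∂P :=
          lintegral_mono h1
      _ = ∫⁻ ω, (A ω * ∫⁻ ω', h ((S k ω).y, (S k ω).z) (fun i => ζ (k, i) ω') ∂P) + A' ω ∂P := by
          rw [lintegral_add_right _ hA'm, h2, ← lintegral_add_right _ hA'm]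
      _ ≤ ∫⁻ ω, ENNReal.ofReal (Real.exp (L / (100 * N))) * V k ω ∂P := lintegral_mono h3
      _ = _ := lintegral_const_mul' _ _ ENNReal.ofReal_ne_top
  have hmain (k : ℕ) (hk : k ≤ N) :
      ∫⁻ ω, V k ω ∂P ≤ ENNReal.ofReal (Real.exp (κ * R ^ 2 + k * (L / (100 * N)))) := by
    induction k with
    | zero =>
      have h1 (ω : Ω) : V 0 ω ≤ ENNReal.ofReal (Real.exp (κ * R ^ 2)) := by
        have hRD : R ≤ constC * R := by
          have : 1 ≤ constC := by rw [constC, Real.one_le_sqrt]; norm_num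
          exact le_mul_of_one_le_left hR.le this
        have hg0 : Good 0 ω := by
          intro j hj
          obtain rfl : j = 0 := by omega
          exact ⟨hx0.trans hRD, hx0.trans hRD, by simp [stepSum]; positivity⟩
        simp only [hV, if_pos hg0]
        refine ENNReal.ofReal_le_ofReal (Real.exp_le_exp.2 (mul_le_mul_of_nonneg_left ?_ hκ0.le))
        simp only [potential, stepSum, hS, run]
        have := pow_le_pow_left₀ (norm_nonneg _) hx0 2
        linarith
      calc ∫⁻ ω, V 0 ω ∂P ≤ ∫⁻ _, ENNReal.ofReal (Real.exp (κ * R ^ 2)) ∂P := lintegral_mono h1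
        _ = _ := by simp
    | succ k ih =>
      refine (hstep k hk).trans ?_
      calc _ ≤ ENNReal.ofReal (Real.exp (L / (100 * N))) *
            ENNReal.ofReal (Real.exp (κ * R ^ 2 + k * (L / (100 * N)))) := by
            gcongr; exact ih (Nat.le_of_succ_le hk)
        _ = _ := by
            rw [← ENNReal.ofReal_mul (Real.exp_pos _).le, ← Real.exp_add]
            congr 2
            push_cast
            ring
  -- Markov's inequality
  have hsub : {ω | ε < f (S N ω).y - f xs} ⊆
      {ω | ENNReal.ofReal (Real.exp (κ * (33 / 10 * R ^ 2))) ≤ V N ω} := by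
    intro ω hω
    simp only [Set.mem_ofPred_eq, hV]
    split_ifs with hgN
    · exact ENNReal.ofReal_le_ofReal (Real.exp_le_exp.2
        (mul_le_mul_of_nonneg_left (hp.le_potential_of_lt hω) hκ0.le))
    · exact le_rfl
  have hVm : Measurable (V N) := by
    refine Measurable.ite (hGm' N) ?_ measurable_const
    refine ENNReal.measurable_ofReal.comp (Real.measurable_exp.comp (Measurable.const_mul ?_ κ))
    exact measurable_potential hfc xs ε ((hSm N N le_rfl).1.mono (hle N) le_rfl)
      ((hSm N N le_rfl).2.mono (hle N) le_rfl)
  have hpos : 0 < Real.exp (κ * (33 / 10 * R ^ 2)) := Real.exp_pos _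
  refine (measure_mono hsub).trans ((meas_ge_le_lintegral_div hVm.aemeasurable
    (by simpa using hpos) ENNReal.ofReal_ne_top).trans ?_)
  refine (ENNReal.div_le_div_right (hmain N le_rfl) _).trans ?_
  rw [← ENNReal.ofReal_div_of_pos hpos, ← Real.exp_sub]
  refine ENNReal.ofReal_le_ofReal (Real.exp_le_exp.2 ?_)
  have h1 : (N : ℝ) * (L / (100 * N)) = L / 100 := by field_simp
  have h2 : κ * R ^ 2 = 4 / 7 * L := by
    rw [hκ, hDR]; field_simp
  have h3 : κ * (33 / 10 * R ^ 2) = 33 / 10 * (κ * R ^ 2) := by ring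
  rw [h1, h3, h2]
  linarith

end Run

/-! ### The parameters of the restarts -/

section RestartParameters

variable {ν M μ R₀ σ β ε : ℝ} {τ : ℕ} {N : ℕ → ℕ} {j : ℕ}

/-- The bound `R₀ / 2^{j/2}` for the distance to the minimizer after `j` restarts. -/
noncomputable def radius (R₀ : ℝ) (j : ℕ) : ℝ := R₀ / (2 : ℝ) ^ ((j : ℝ) / 2)

theorem radius_pos (hR : 0 < R₀) (j : ℕ) : 0 < radius R₀ j := by unfold radius; positivity

theorem radius_sq (R₀ : ℝ) (j : ℕ) : radius R₀ j ^ 2 = R₀ ^ 2 / 2 ^ j := by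
  rw [radius, div_pow, ← Real.rpow_natCast (2 ^ ((j : ℝ) / 2)), ← Real.rpow_mul (by norm_num),
    ← Real.rpow_natCast 2 j]
  congr 2
  push_cast
  ring

theorem radius_le (hR : 0 < R₀) (j : ℕ) : radius R₀ j ≤ R₀ :=
  div_le_self hR.le (Real.one_le_rpow (by norm_num) (by positivity))

theorem accuracy_pos (hμ : 0 < μ) (hR : 0 < R₀) (t : ℕ) : 0 < accuracy μ R₀ t := by
  unfold accuracy; positivity

theorem accuracy_succ (μ R₀ : ℝ) (j : ℕ) :
    accuracy μ R₀ (j + 1) = μ * radius R₀ j ^ 2 / 4 := by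
  rw [radius_sq, accuracy]; field_simp; ring

theorem two_mul_accuracy (μ R₀ : ℝ) (t : ℕ) : 2 * accuracy μ R₀ t = μ * radius R₀ t ^ 2 := by
  rw [radius_sq, accuracy]; field_simp; ring

theorem cast_succ_sub_one (j : ℕ) : ((j + 1 : ℕ) : ℝ) - 1 = j := by push_cast; ring

theorem succ_mem_Icc (hj : j < τ) : j + 1 ∈ Finset.Icc 1 τ := by
  rw [Finset.mem_Icc]; omega

/-- The number of iterations in restart `j + 1`, before rounding. -/
noncomputable def iterationBound (ν M μ R₀ L : ℝ) (j : ℕ) : ℝ :=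
  (2 * (16384 * L ^ 2)) ^ ((1 + ν) / (1 + 3 * ν)) *
    (constC * radius R₀ j) ^ (2 * (1 + ν) / (1 + 3 * ν)) * M ^ (2 / (1 + 3 * ν)) /
      accuracy μ R₀ (j + 1) ^ (2 / (1 + 3 * ν))

theorem Admissible.N_succ (h : Admissible ν M μ R₀ β τ N) (hν : 0 ≤ ν) (hR : 0 < R₀)
    (hj : j < τ) : N (j + 1) = ⌈iterationBound ν M μ R₀ (logNt β τ N (j + 1)) j⌉₊ + 1 := by
  have h1 := h.iterations_eq (j + 1) (succ_mem_Icc hj)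
  rw [cast_succ_sub_one] at h1
  rw [h1]
  congr 2
  have hL : 0 < logNt β τ N (j + 1) := by linarith [h.two_le_log (j + 1) (succ_mem_Icc hj)]
  have hC := constC_pos
  rw [iterationBound, paramA]
  have ha : 0 < 16384 * logNt β τ N (j + 1) ^ 2 := by positivity
  generalize 16384 * logNt β τ N (j + 1) ^ 2 = a at ha
  rw [radius, ← mul_div_assoc, Real.div_rpow (by positivity) (by positivity),
    Real.mul_rpow (by positivity) hR.le, Real.mul_rpow (by norm_num) (by positivity),
    ← Real.rpow_mul (by norm_num)]
  have h2 : (j : ℝ) / 2 * (2 * (1 + ν) / (1 + 3 * ν)) = (1 + ν) * j / (1 + 3 * ν) := by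
    field_simp
  rw [h2]
  field_simp

theorem Admissible.le_iterationBound (h : Admissible ν M μ R₀ β τ N) (hν : 0 ≤ ν) (hM : 0 < M)
    (hμ : 0 < μ) (hR : 0 < R₀) (hj : j < τ) :
    100 ≤ iterationBound ν M μ R₀ (logNt β τ N (j + 1)) j := by
  have h1 := h.accuracy_le₂ (j + 1) (succ_mem_Icc hj)
  rw [cast_succ_sub_one] at h1
  have hL : 0 < logNt β τ N (j + 1) := by linarith [h.two_le_log (j + 1) (succ_mem_Icc hj)]
  have hC := constC_pos
  have hε := accuracy_pos hμ hR (j + 1)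
  unfold iterationBound
  rw [paramA] at h1
  set ε := accuracy μ R₀ (j + 1)
  have ha : 0 < 16384 * logNt β τ N (j + 1) ^ 2 := by positivity
  generalize 16384 * logNt β τ N (j + 1) ^ 2 = a at *
  have hr := radius_pos hR j
  set D := constC * radius R₀ j with hD
  have hD0 : 0 < D := by positivity
  have h2 : (2 : ℝ) ^ ((1 + ν) / 2) * a ^ ((1 + ν) / 2) * constC ^ (1 + ν) * R₀ ^ (1 + ν) * M /
      ((100 : ℝ) ^ ((1 + 3 * ν) / 2) * (2 : ℝ) ^ ((1 + ν) * j / 2)) =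
      (2 * a) ^ ((1 + ν) / 2) * D ^ (1 + ν) * M / (100 : ℝ) ^ ((1 + 3 * ν) / 2) := by
    rw [hD, radius, ← mul_div_assoc, Real.div_rpow (by positivity) (by positivity),
      Real.mul_rpow (by positivity) hR.le, Real.mul_rpow (by norm_num) (by positivity),
      ← Real.rpow_mul (by norm_num)]
    have h2 : (j : ℝ) / 2 * (1 + ν) = (1 + ν) * j / 2 := by ring
    rw [h2]
    field_simp
  rw [h2, le_div_iff₀ (by positivity)] at h1
  have h3 := Real.rpow_le_rpow (by positivity) h1 (by positivity : 0 ≤ 2 / (1 + 3 * ν))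
  have hne : 1 + 3 * ν ≠ 0 := by positivity
  rw [Real.mul_rpow hε.le (by positivity), Real.mul_rpow (by positivity) (by positivity),
    Real.mul_rpow (by positivity) (by positivity), ← Real.rpow_mul (by norm_num),
    ← Real.rpow_mul (by positivity), ← Real.rpow_mul (by positivity)] at h3
  have e1 : (1 + 3 * ν) / 2 * (2 / (1 + 3 * ν)) = 1 := by field_simp
  have e2 : (1 + ν) / 2 * (2 / (1 + 3 * ν)) = (1 + ν) / (1 + 3 * ν) := by field_simp
  have e3 : (1 + ν) * (2 / (1 + 3 * ν)) = 2 * (1 + ν) / (1 + 3 * ν) := by ring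
  rw [e1, e2, e3, Real.rpow_one] at h3
  rw [le_div_iff₀ (by positivity)]
  linarith

theorem Admissible.runBounds (h : Admissible ν M μ R₀ β τ N) (hν : 0 ≤ ν) (hν' : ν ≤ 1)
    (hM : 0 < M) (hμ : 0 < μ) (hR : 0 < R₀) (hj : j < τ)
    (hμM : μ * radius R₀ j ^ (1 - ν) ≤ M) :
    RunBounds ν M (radius R₀ j) (accuracy μ R₀ (j + 1)) (logNt β τ N (j + 1))
      (paramAlpha ν M μ R₀ β τ N (j + 1)) (N (j + 1)) := by
  have hr := radius_pos hR j
  refine ClippedSSTM.runBounds hν hν' hM (accuracy_pos hμ hR _) hr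
    (h.two_le_log (j + 1) (succ_mem_Icc hj)) rfl (X := iterationBound ν M μ R₀ _ j) rfl
    (h.N_succ hν hR hj) (h.le_iterationBound hν hM hμ hR hj) ?_
  rw [accuracy_succ]
  have h1 : radius R₀ j ^ 2 = radius R₀ j ^ (1 - ν) * radius R₀ j ^ (1 + ν) := by
    rw [← Real.rpow_add hr, ← Real.rpow_natCast]
    congr 1
    push_cast
    ring
  calc μ * radius R₀ j ^ 2 / 4 ≤ μ * radius R₀ j ^ 2 :=
        div_le_self (by positivity) (by norm_num)
    _ = μ * radius R₀ j ^ (1 - ν) * radius R₀ j ^ (1 + ν) := by rw [h1]; ring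
    _ ≤ M * radius R₀ j ^ (1 + ν) := by gcongr

theorem paramB_succ (R₀ β : ℝ) (τ : ℕ) (N : ℕ → ℕ) (j : ℕ) :
    paramB R₀ β τ N (j + 1) = constC * radius R₀ j / (16 * logNt β τ N (j + 1)) := by
  rw [paramB, cast_succ_sub_one, radius]
  have : (0 : ℝ) < 2 ^ ((j : ℝ) / 2) := by positivity
  rw [← mul_div_assoc, div_div]
  congr 1
  ring

/-- The argument of the rounding in the batchsize, in terms of the radius. -/
theorem batchSize_succ (hR : 0 < R₀) (k : ℕ) :
    batchSize ν M μ R₀ σ β τ N (j + 1) k = ⌈max 1 (20736 * N (j + 1) * σ ^ 2 *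
      stepSize (paramAlpha ν M μ R₀ β τ N (j + 1)) ν (k + 1) ^ 2 * logNt β τ N (j + 1) /
        (constC * radius R₀ j) ^ 2)⌉₊ := by
  rw [batchSize, cast_succ_sub_one, mul_pow, radius_sq, Real.rpow_natCast]
  congr 2
  have := constC_pos
  field_simp

theorem batchSize_pos (ν M μ R₀ σ β : ℝ) (τ : ℕ) (N : ℕ → ℕ) (t k : ℕ) :
    0 < batchSize ν M μ R₀ σ β τ N t k :=
  Nat.ceil_pos.2 (zero_lt_one.trans_le (le_max_left _ _))

/-- The batchsize makes the variance of the mini-batch small relative to the stepsize. -/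
theorem stepSize_sq_mul_le (hR : 0 < R₀) (hL : 0 < logNt β τ N (j + 1)) (hN : 0 < N (j + 1))
    (k : ℕ) :
    stepSize (paramAlpha ν M μ R₀ β τ N (j + 1)) ν (k + 1) ^ 2 *
        (σ ^ 2 / batchSize ν M μ R₀ σ β τ N (j + 1) k) ≤
      (constC * radius R₀ j) ^ 2 / (20736 * N (j + 1) * logNt β τ N (j + 1)) := by
  have hm := batchSize_pos ν M μ R₀ σ β τ N (j + 1) k
  have hr := radius_pos hR j
  have hC := constC_pos
  have h1 : 20736 * N (j + 1) * σ ^ 2 *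
      stepSize (paramAlpha ν M μ R₀ β τ N (j + 1)) ν (k + 1) ^ 2 * logNt β τ N (j + 1) /
        (constC * radius R₀ j) ^ 2 ≤ batchSize ν M μ R₀ σ β τ N (j + 1) k := by
    rw [batchSize_succ hR]
    exact (le_max_right _ _).trans (Nat.le_ceil _)
  have hm' : (0 : ℝ) < batchSize ν M μ R₀ σ β τ N (j + 1) k := by exact_mod_cast hm
  have hN' : (0 : ℝ) < N (j + 1) := by exact_mod_cast hN
  rw [div_le_iff₀ (by positivity)] at h1
  rw [← mul_div_assoc, div_le_div_iff₀ hm' (by positivity)]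
  linarith

/-- One run fails with at most its share of the total failure probability. -/
theorem exp_neg_logNt_le (hβ : 0 < β) (hτ : 0 < τ) {t : ℕ} (hN : 0 < N t) :
    Real.exp (-logNt β τ N t) ≤ β / τ := by
  have hN' : (1 : ℝ) ≤ N t := by exact_mod_cast hN
  have hτ' : (0 : ℝ) < τ := by exact_mod_cast hτ
  rw [logNt, Real.exp_neg, Real.exp_log (by positivity), inv_div]
  gcongr
  nlinarith

theorem accuracy_numRestarts_le (hε : 0 < ε) (h : 2 * ε < μ * R₀ ^ 2) :
    accuracy μ R₀ (numRestarts μ R₀ ε) ≤ ε := by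
  have h0 : 0 < μ * R₀ ^ 2 / (2 * ε) := div_pos (by linarith) (by positivity)
  have h1 := Nat.le_ceil (Real.logb 2 (μ * R₀ ^ 2 / (2 * ε)))
  rw [Real.logb_le_iff_le_rpow (by norm_num) h0, Real.rpow_natCast, div_le_iff₀ (by positivity)]
    at h1
  rw [accuracy, div_le_iff₀ (by positivity), pow_succ 2]
  unfold numRestarts
  linarith

theorem numRestarts_pos (hε : 0 < ε) (h : 2 * ε < μ * R₀ ^ 2) : 0 < numRestarts μ R₀ ε :=
  Nat.ceil_pos.2 (Real.logb_pos (by norm_num) ((one_lt_div (by positivity)).2 h))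

end RestartParameters

/-! ### The failure probability of the restarted method -/

section Restarts

variable {n : ℕ} {f : EuclideanSpace ℝ (Fin n) → ℝ} {μ ν M R₀ β σ : ℝ} {N : ℕ → ℕ} {τ : ℕ}
  {xs x0 : EuclideanSpace ℝ (Fin n)} {Ξ Ω : Type*} [MeasurableSpace Ξ] [MeasurableSpace Ω]
  {D : Measure Ξ} {P : Measure Ω} [IsProbabilityMeasure P]
  {G : EuclideanSpace ℝ (Fin n) → Ξ → EuclideanSpace ℝ (Fin n)}

theorem measurable_restartedRun {Ω : Type*} [MeasurableSpace Ω]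
    (hG : Measurable (Function.uncurry G)) (α B : ℕ → ℝ)
    (m : ℕ → ℕ → ℕ) (x0 : EuclideanSpace ℝ (Fin n)) {s : Ω → ℕ → ℕ → ℕ → Ξ} {t : ℕ}
    (hs : ∀ r ≤ t, ∀ k i, Measurable fun ω => s ω r k i) :
    Measurable fun ω => (restartedRun G ν x0 N α B m (s ω) t).point := by
  induction t with
  | zero => exact measurable_const
  | succ t ih =>
    exact (measurable_run hG (m (t + 1)) (ih fun r hr => hs r (hr.trans (Nat.le_succ t)))
      fun j _ i => hs (t + 1) le_rfl j i).1

/-- After `t` restarts, the point is within the distance `R₀ / 2^{t/2}` of the minimizer and, if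
`t ≥ 1`, has the accuracy `ε_t`, except with probability `t β / τ`. -/
theorem measure_restartedRun_le (hν : 0 ≤ ν) (hν' : ν ≤ 1) (hn : 0 < n) (hM : 0 < M) (hμ : 0 < μ)
    (hR : 0 < R₀) (hβ : 0 < β)
    (hf : IsStronglyConvex f μ) (hmin : ∀ x, f xs ≤ f x) (hx0 : ‖x0 - xs‖ ≤ R₀)
    (hQ : HasHolderGradientOn f ν M (Metric.closedBall xs (3 * R₀)))
    (hG : IsStochasticGradient f G D σ) {ξ : ℕ × ℕ × ℕ → Ω → Ξ}
    (hξ : ∀ j, Measurable (ξ j)) (hD : ∀ j, P.map (ξ j) = D) (hi : iIndepFun ξ P)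
    (hadm : Admissible ν M μ R₀ β τ N) {t : ℕ} (ht : t ≤ τ) {X : ℕ → Ω → EuclideanSpace ℝ (Fin n)}
    (hX : X = fun t ω => (restartedRun G ν x0 N (paramAlpha ν M μ R₀ β τ N) (paramB R₀ β τ N)
      (batchSize ν M μ R₀ σ β τ N) (fun t k i => ξ (t, k, i) ω) t).point) :
    P {ω | ¬ (‖X t ω - xs‖ ≤ radius R₀ t ∧ (0 < t → f (X t ω) - f xs ≤ accuracy μ R₀ t))} ≤
      ENNReal.ofReal (t * (β / τ)) := by
  have hfc : Continuous f := hf.differentiable.continuous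
  induction t with
  | zero =>
    have : radius R₀ 0 = R₀ := by simp [radius]
    simp [this, hX, restartedRun, hx0]
  | succ t ih =>
    have htτ : t < τ := ht
    have hτ : 0 < τ := by omega
    have hrt := radius_pos hR t
    have hrt1 := radius_pos hR (t + 1)
    have hsub : Metric.closedBall xs (3 * radius R₀ t) ⊆ Metric.closedBall xs (3 * R₀) :=
      Metric.closedBall_subset_closedBall (by linarith [radius_le hR t])
    have hQt : HasHolderGradientOn f ν M (Metric.closedBall xs (3 * radius R₀ t)) :=
      fun x hx y hy => hQ x (hsub hx) y (hsub hy)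
    have hp := hadm.runBounds hν hν' hM hμ hR htτ (hf.mul_rpow_le hmin hn hrt hQt)
    have hLpos : 0 < logNt β τ N (t + 1) := by linarith [hp.two_le]
    set α := paramAlpha ν M μ R₀ β τ N (t + 1)
    set B := paramB R₀ β τ N (t + 1) with hB
    set m := batchSize ν M μ R₀ σ β τ N (t + 1) with hm
    set ε := accuracy μ R₀ (t + 1) with hε
    have hXs (ω : Ω) : X (t + 1) ω =
        (run G ν (X t ω) α B m (fun k i => ξ (t + 1, k, i) ω) (N (t + 1))).y := by
      rw [hX]; rfl
    set good : Set Ω := {ω | ‖X t ω - xs‖ ≤ radius R₀ t} with hgood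
    have hsplit : {ω | ¬ (‖X (t + 1) ω - xs‖ ≤ radius R₀ (t + 1) ∧
          (0 < t + 1 → f (X (t + 1) ω) - f xs ≤ ε))} ⊆
        {ω | ¬ (‖X t ω - xs‖ ≤ radius R₀ t ∧ (0 < t → f (X t ω) - f xs ≤ accuracy μ R₀ t))} ∪
          (good ∩ {ω | ε < f (X (t + 1) ω) - f xs}) := by
      intro ω hω
      by_cases hgt : ω ∈ good
      · refine Or.inr ⟨hgt, ?_⟩
        by_contra hle
        have hle' : f (X (t + 1) ω) - f xs ≤ ε := not_lt.1 hle
        refine hω ⟨?_, fun _ => hle'⟩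
        have h1 := hf.sq_dist_le hmin (X (t + 1) ω)
        have h2 := two_mul_accuracy μ R₀ (t + 1)
        refine le_of_sq_le_sq ?_ hrt1.le
        refine le_of_mul_le_mul_left ?_ hμ
        linarith
      · exact Or.inl fun h => hgt h.1
    -- the samples of the current restart are independent of its starting point
    have hXm : Measurable[sigmaOf ξ {p | p.1 ≤ t}] (X t) := by
      rw [hX]
      exact @measurable_restartedRun n ν N Ξ _ G Ω (sigmaOf ξ {p | p.1 ≤ t}) hG.measurable _ _ _ x0
        (fun ω t k i => ξ (t, k, i) ω) t fun r hr k i => measurable_sigmaOf (by exact hr)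
    have hYm : Measurable[sigmaOf ξ {p | p.1 = t + 1}] (fun ω k i => ξ (t + 1, k, i) ω) :=
      @measurable_pi_lambda _ _ _ (sigmaOf ξ {p | p.1 = t + 1}) _ _ fun k =>
        @measurable_pi_lambda _ _ _ (sigmaOf ξ {p | p.1 = t + 1}) _ _ fun i =>
          measurable_sigmaOf (by exact rfl)
    have hgm : MeasurableSet[sigmaOf ξ {p | p.1 ≤ t}] good :=
      hXm (measurableSet_le (measurable_id.sub_const xs).norm measurable_const)
    set F : Set (EuclideanSpace ℝ (Fin n) × (ℕ → ℕ → Ξ)) :=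
      {q | ε < f (run G ν q.1 α B m q.2 (N (t + 1))).y - f xs} with hF
    have hFm : MeasurableSet F := by
      refine measurableSet_lt measurable_const ((hfc.measurable.comp ?_).sub_const _)
      exact (measurable_run hG.measurable m (x0 := fun q : EuclideanSpace ℝ (Fin n) ×
        (ℕ → ℕ → Ξ) => q.1) (s := fun q => q.2) measurable_fst fun j _ i =>
        (measurable_pi_apply i).comp ((measurable_pi_apply j).comp measurable_snd)).1
    have hle1 := sigmaOf_le hξ {p : ℕ × ℕ × ℕ | p.1 ≤ t}
    have hgm' : MeasurableSet good := hle1 _ hgm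
    have hfub := lintegral_mul_of_indep hle1 (sigmaOf_le hξ {p | p.1 = t + 1})
      (indep_sigmaOf hξ hi (Set.disjoint_left.2 fun p (hp1 : p.1 ≤ t) (hp2 : p.1 = t + 1) => by
        omega))
      (A := good.indicator 1)
      (Measurable.indicator (@measurable_const _ _ _ (sigmaOf ξ {p | p.1 ≤ t}) 1) hgm) hXm hYm
      (h := fun x s => F.indicator 1 (x, s)) (measurable_const.indicator hFm)
    have hlhs : ∫⁻ ω, good.indicator 1 ω * F.indicator
          (1 : EuclideanSpace ℝ (Fin n) × (ℕ → ℕ → Ξ) → ENNReal)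
        (X t ω, fun k i => ξ (t + 1, k, i) ω) ∂P =
        P (good ∩ {ω | ε < f (X (t + 1) ω) - f xs}) := by
      have hmeas : MeasurableSet (good ∩ {ω | ε < f (X (t + 1) ω) - f xs}) := by
        refine hgm'.inter ?_
        have h1 : Measurable fun ω => (X t ω, fun k i => ξ (t + 1, k, i) ω) :=
          (hXm.mono hle1 le_rfl).prodMk (hYm.mono (sigmaOf_le hξ {p | p.1 = t + 1}) le_rfl)
        have h2 := h1 hFm
        simp_rw [hXs]
        exact h2
      rw [← lintegral_indicator_one hmeas]
      refine lintegral_congr fun ω => ?_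
      rw [Set.inter_indicator_one, Pi.mul_apply]
      congr 1
      simp only [Set.indicator_apply, hF, Set.mem_ofPred_eq, hXs, Pi.one_apply]
    have hrun (x : EuclideanSpace ℝ (Fin n)) (hx : ‖x - xs‖ ≤ radius R₀ t) :
        ∫⁻ ω, F.indicator (1 : EuclideanSpace ℝ (Fin n) × (ℕ → ℕ → Ξ) → ENNReal)
          (x, fun k i => ξ (t + 1, k, i) ω) ∂P ≤
          ENNReal.ofReal (β / τ) := by
      have h1 := hp.measure_lt_le hf hμ.le hmin hQt hG (ζ := fun p => ξ (t + 1, p))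
        (fun p => hξ _) (fun p => hD _)
        (hi.precomp (g := fun p => (t + 1, p)) fun p q hpq => (Prod.ext_iff.1 hpq).2)
        (m := m) (fun k _ => batchSize_pos ν M μ R₀ σ β τ N (t + 1) k)
        (fun k _ => stepSize_sq_mul_le hR hLpos hp.N_pos k) hx
      rw [← paramB_succ, ← hB] at h1
      refine le_trans ?_ (h1.trans (ENNReal.ofReal_le_ofReal (exp_neg_logNt_le hβ hτ hp.N_pos)))
      have h2 : ∀ ω, F.indicator (1 : EuclideanSpace ℝ (Fin n) × (ℕ → ℕ → Ξ) → ENNReal)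
          (x, fun k i => ξ (t + 1, k, i) ω) =
          {ω | ε < f (run G ν x α B m (fun k i => ξ (t + 1, k, i) ω) (N (t + 1))).y -
            f xs}.indicator 1 ω := fun ω => rfl
      simp_rw [h2]
      exact lintegral_indicator_one_le _
    have hfail : P (good ∩ {ω | ε < f (X (t + 1) ω) - f xs}) ≤ ENNReal.ofReal (β / τ) := by
      rw [← hlhs, hfub]
      calc _ ≤ ∫⁻ _, ENNReal.ofReal (β / τ) ∂P := by
            refine lintegral_mono fun ω => ?_
            by_cases hω : ω ∈ good
            · rw [Set.indicator_of_mem hω, Pi.one_apply, one_mul]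
              exact hrun _ hω
            · rw [Set.indicator_of_notMem hω, zero_mul]
              exact zero_le
        _ = _ := by simp
    refine (measure_mono hsplit).trans ((measure_union_le _ _).trans ?_)
    refine (add_le_add (ih htτ.le) hfail).trans ?_
    rw [← ENNReal.ofReal_add (by positivity) (by positivity)]
    refine ENNReal.ofReal_le_ofReal (le_of_eq ?_)
    push_cast
    ring

end Restarts

/-! ### The counters -/

section Counters

variable {E Ξ : Type*} [NormedAddCommGroup E] [NormedSpace ℝ E] (G : E → Ξ → E) (ν : ℝ)

theorem run_iterations (x0 : E) (α B : ℝ) (m : ℕ → ℕ) (s : ℕ → ℕ → Ξ) (k : ℕ) :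
    (run G ν x0 α B m s k).iterations = k := by
  induction k with
  | zero => rfl
  | succ k ih => simp only [run, step, ih]

theorem run_oracleCalls (x0 : E) (α B : ℝ) (m : ℕ → ℕ) (s : ℕ → ℕ → Ξ) (k : ℕ) :
    (run G ν x0 α B m s k).oracleCalls = ∑ i ∈ Finset.range k, m i := by
  induction k with
  | zero => rfl
  | succ k ih => rw [Finset.sum_range_succ, ← ih]; rfl

theorem restartedRun_iterations (x0 : E) (N : ℕ → ℕ) (α B : ℕ → ℝ) (m : ℕ → ℕ → ℕ)
    (s : ℕ → ℕ → ℕ → Ξ) (t : ℕ) :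
    (restartedRun G ν x0 N α B m s t).iterations = ∑ j ∈ Finset.range t, N (j + 1) := by
  induction t with
  | zero => rfl
  | succ t ih => rw [Finset.sum_range_succ, ← ih]; simp only [restartedRun, run_iterations]

theorem restartedRun_oracleCalls (x0 : E) (N : ℕ → ℕ) (α B : ℕ → ℝ) (m : ℕ → ℕ → ℕ)
    (s : ℕ → ℕ → ℕ → Ξ) (t : ℕ) :
    (restartedRun G ν x0 N α B m s t).oracleCalls =
      ∑ j ∈ Finset.range t, ∑ k ∈ Finset.range (N (j + 1)), m (j + 1) k := by
  induction t with
  | zero => rfl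
  | succ t ih => rw [Finset.sum_range_succ, ← ih]; simp only [restartedRun, run_oracleCalls]

end Counters

/-! ### The number of restarts -/

section Rates

variable {ν M μ R₀ σ β ε L : ℝ} {τ : ℕ} {N : ℕ → ℕ} {j : ℕ}

theorem two_pow_numRestarts_le (hε : 0 < ε) (h : 2 * ε < μ * R₀ ^ 2) :
    (2 : ℝ) ^ numRestarts μ R₀ ε ≤ μ * R₀ ^ 2 / ε := by
  have h0 : 1 < μ * R₀ ^ 2 / (2 * ε) := (one_lt_div (by positivity)).2 h
  have h1 := Nat.ceil_lt_add_one (Real.logb_pos (b := 2) (by norm_num) h0).le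
  rw [← numRestarts] at h1
  have h2 : (numRestarts μ R₀ ε : ℝ) - 1 < Real.logb 2 (μ * R₀ ^ 2 / (2 * ε)) := by linarith
  rw [Real.lt_logb_iff_rpow_lt (by norm_num) (by linarith), Real.rpow_sub (by norm_num),
    Real.rpow_natCast, Real.rpow_one, div_lt_iff₀ (by norm_num)] at h2
  refine h2.le.trans (le_of_eq ?_)
  field_simp

theorem numRestarts_le (hε : 0 < ε) (h : 2 * ε < μ * R₀ ^ 2) :
    (numRestarts μ R₀ ε : ℝ) ≤ 2 * Real.log (μ * R₀ ^ 2 / ε) := by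
  have h1 := Real.log_le_log (by positivity) (two_pow_numRestarts_le hε h)
  rw [Real.log_pow] at h1
  have h2 := Real.log_two_gt_d9
  have h3 : (0 : ℝ) ≤ numRestarts μ R₀ ε := Nat.cast_nonneg _
  nlinarith

theorem one_half_le_log (hε : 0 < ε) (h : 2 * ε < μ * R₀ ^ 2) :
    1 / 2 ≤ Real.log (μ * R₀ ^ 2 / ε) := by
  have h1 : (2 : ℝ) ≤ μ * R₀ ^ 2 / ε := (le_div_iff₀ hε).2 h.le
  have h2 := Real.log_le_log (by norm_num) h1
  linarith [Real.log_two_gt_d9]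

/-! ### The number of iterations -/

/-- The factor `(M / (μ R₀^{1-ν}))^{2/(1+3ν)}` of the complexity. -/
noncomputable def initialRate (ν M μ R₀ : ℝ) : ℝ := (M / (μ * R₀ ^ (1 - ν))) ^ (2 / (1 + 3 * ν))

/-- The term `(M² / (μ^{1+ν} ε^{1-ν}))^{1/(1+3ν)}` of the complexity. -/
noncomputable def finalRate (ν M μ ε : ℝ) : ℝ :=
  (M ^ 2 / (μ ^ (1 + ν) * ε ^ (1 - ν))) ^ (1 / (1 + 3 * ν))

theorem initialRate_pos (hM : 0 < M) (hμ : 0 < μ) (hR : 0 < R₀) : 0 < initialRate ν M μ R₀ := by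
  unfold initialRate; positivity

theorem finalRate_pos (hM : 0 < M) (hμ : 0 < μ) (hε : 0 < ε) : 0 < finalRate ν M μ ε := by
  unfold finalRate; positivity

theorem complexity_eq (ν M μ R₀ ε : ℝ) : complexity ν M μ R₀ ε =
    max (initialRate ν M μ R₀ * Real.log (μ * R₀ ^ 2 / ε)) (finalRate ν M μ ε) := rfl

theorem logFactor_eq (hM : 0 < M) (hμ : 0 < μ) (hε : 0 < ε) :
    logFactor ν M μ R₀ ε β =
      Real.log (finalRate ν M μ ε * Real.log (μ * R₀ ^ 2 / ε) / β) := by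
  have e1 : (2 : ℕ) * (1 / (1 + 3 * ν)) = 2 / (1 + 3 * ν) := by push_cast; ring
  have e2 : (1 + ν) * (1 / (1 + 3 * ν)) = (1 + ν) / (1 + 3 * ν) := by ring
  have e3 : (1 - ν) * (1 / (1 + 3 * ν)) = (1 - ν) / (1 + 3 * ν) := by ring
  rw [logFactor, finalRate, Real.div_rpow (by positivity) (by positivity),
    Real.mul_rpow (by positivity) (by positivity), ← Real.rpow_natCast M, ← Real.rpow_mul hM.le,
    ← Real.rpow_mul hμ.le, ← Real.rpow_mul hε.le, e1, e2, e3]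
  congr 1
  field_simp

/-- The two rates differ by the growth over all restarts. -/
theorem initialRate_mul_rpow (hν : 0 ≤ ν) (hM : 0 < M) (hμ : 0 < μ) (hR : 0 < R₀) (hε : 0 < ε) :
    initialRate ν M μ R₀ * (μ * R₀ ^ 2 / ε) ^ ((1 - ν) / (1 + 3 * ν)) = finalRate ν M μ ε := by
  unfold initialRate finalRate
  have hM' := (Real.exp_log hM).symm
  have hμ' := (Real.exp_log hμ).symm
  have hR' := (Real.exp_log hR).symm
  have hε' := (Real.exp_log hε).symm
  rw [hM', hμ', hR', hε', ← Real.rpow_natCast, ← Real.rpow_natCast]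
  simp only [← Real.exp_mul, ← Real.exp_add, ← Real.exp_sub]
  congr 1
  push_cast
  field_simp
  ring

/-- The size of `N_{j+1}`, up to a numerical constant: it grows geometrically in `j` with the
ratio `2^{(1-ν)/(1+3ν)}`. -/
theorem iterationBound_le (hν : 0 ≤ ν) (hM : 0 < M) (hμ : 0 < μ) (hR : 0 < R₀)
    (hL : 0 < L) (j : ℕ) :
    iterationBound ν M μ R₀ L j ≤ 3670016 *
      (initialRate ν M μ R₀ * ((2 : ℝ) ^ ((1 - ν) / (1 + 3 * ν))) ^ j) *
        L ^ (2 * (1 + ν) / (1 + 3 * ν)) := by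
  have hr := radius_pos hR j
  have hC := constC_pos
  have h3 : 0 < 1 + 3 * ν := by positivity
  have e1 : iterationBound ν M μ R₀ L j = 32768 ^ ((1 + ν) / (1 + 3 * ν)) *
      7 ^ ((1 + ν) / (1 + 3 * ν)) * 4 ^ (2 / (1 + 3 * ν)) *
      (initialRate ν M μ R₀ * ((2 : ℝ) ^ ((1 - ν) / (1 + 3 * ν))) ^ j) *
        L ^ (2 * (1 + ν) / (1 + 3 * ν)) := by
    have f1 : (2 * (16384 * L ^ 2)) ^ ((1 + ν) / (1 + 3 * ν)) =
        32768 ^ ((1 + ν) / (1 + 3 * ν)) * L ^ (2 * (1 + ν) / (1 + 3 * ν)) := by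
      rw [show 2 * (16384 * L ^ 2) = 32768 * L ^ 2 by ring,
        Real.mul_rpow (by norm_num) (by positivity), ← Real.rpow_natCast L, ← Real.rpow_mul hL.le]
      congr 2
      push_cast
      ring
    have f2 : (constC * radius R₀ j) ^ (2 * (1 + ν) / (1 + 3 * ν)) =
        7 ^ ((1 + ν) / (1 + 3 * ν)) * radius R₀ j ^ (2 * (1 + ν) / (1 + 3 * ν)) := by
      rw [Real.mul_rpow hC.le hr.le, ← constC_sq, ← Real.rpow_natCast constC,
        ← Real.rpow_mul hC.le]
      congr 2
      push_cast
      ring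
    have f3 : accuracy μ R₀ (j + 1) ^ (2 / (1 + 3 * ν)) =
        (μ * radius R₀ j ^ 2) ^ (2 / (1 + 3 * ν)) / 4 ^ (2 / (1 + 3 * ν)) := by
      rw [accuracy_succ, Real.div_rpow (by positivity) (by norm_num)]
    have f4 : radius R₀ j ^ (2 * (1 + ν) / (1 + 3 * ν)) * M ^ (2 / (1 + 3 * ν)) /
        (μ * radius R₀ j ^ 2) ^ (2 / (1 + 3 * ν)) =
        initialRate ν M μ R₀ * ((2 : ℝ) ^ ((1 - ν) / (1 + 3 * ν))) ^ j := by
      unfold initialRate radius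
      have hM' := (Real.exp_log hM).symm
      have hμ' := (Real.exp_log hμ).symm
      have hR' := (Real.exp_log hR).symm
      have h2 : (2 : ℝ) = Real.exp (Real.log 2) := (Real.exp_log (by norm_num)).symm
      generalize Real.log M = lM at hM'
      generalize Real.log μ = lμ at hμ'
      generalize Real.log R₀ = lR at hR'
      generalize Real.log 2 = l2 at h2
      have h2' (x : ℝ) : (2 : ℝ) ^ x = Real.exp (l2 * x) := by rw [h2, ← Real.exp_mul]
      rw [h2' ((1 - ν) / (1 + 3 * ν)), h2' ((j : ℝ) / 2), hM', hμ', hR', ← Real.rpow_natCast,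
        ← Real.rpow_natCast]
      simp only [← Real.exp_mul, ← Real.exp_add, ← Real.exp_sub]
      congr 1
      push_cast
      field_simp
      ring
    rw [iterationBound, f1, f2, f3, ← f4]
    field_simp
  have hT := initialRate_pos (ν := ν) hM hμ hR
  have g1 : (1 + ν) / (1 + 3 * ν) ≤ 1 := (div_le_one h3).2 (by linarith)
  have g2 : 2 / (1 + 3 * ν) ≤ 2 := div_le_self (by norm_num) (by linarith)
  have b1 : (32768 : ℝ) ^ ((1 + ν) / (1 + 3 * ν)) ≤ 32768 := by
    simpa using Real.rpow_le_rpow_of_exponent_le (x := 32768) (by norm_num) g1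
  have b2 : (7 : ℝ) ^ ((1 + ν) / (1 + 3 * ν)) ≤ 7 := by
    simpa using Real.rpow_le_rpow_of_exponent_le (x := 7) (by norm_num) g1
  have b3 : (4 : ℝ) ^ (2 / (1 + 3 * ν)) ≤ 16 := by
    refine (Real.rpow_le_rpow_of_exponent_le (x := 4) (by norm_num) g2).trans ?_
    rw [Real.rpow_two]; norm_num
  rw [e1]
  gcongr
  calc _ ≤ (32768 : ℝ) * 7 * 16 := by gcongr
    _ = 3670016 := by norm_num

/-- The constant `2 + ρ / (ρ - 1)` with the ratio `ρ = 2^{(1-ν)/(1+3ν)}`. For `ν = 1` the ratio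
is `1`, and the fraction vanishes by the convention for division by zero. -/
noncomputable def rateConst (ν : ℝ) : ℝ :=
  2 + (2 : ℝ) ^ ((1 - ν) / (1 + 3 * ν)) / ((2 : ℝ) ^ ((1 - ν) / (1 + 3 * ν)) - 1)

theorem one_le_ratio (hν : 0 ≤ ν) (hν' : ν ≤ 1) : (1 : ℝ) ≤ 2 ^ ((1 - ν) / (1 + 3 * ν)) :=
  Real.one_le_rpow (by norm_num) (div_nonneg (by linarith) (by positivity))

theorem two_le_rateConst (hν : 0 ≤ ν) (hν' : ν ≤ 1) : 2 ≤ rateConst ν := by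
  have h := one_le_ratio hν hν'
  exact le_add_of_nonneg_right (div_nonneg (by linarith) (by linarith))

theorem initialRate_mul_pow_le (hν : 0 ≤ ν) (hν' : ν ≤ 1) (hM : 0 < M) (hμ : 0 < μ) (hR : 0 < R₀)
    (hε : 0 < ε) (h : 2 * ε < μ * R₀ ^ 2) (hj : j ≤ numRestarts μ R₀ ε) :
    initialRate ν M μ R₀ * ((2 : ℝ) ^ ((1 - ν) / (1 + 3 * ν))) ^ j ≤ finalRate ν M μ ε := by
  have hT := initialRate_pos (ν := ν) hM hμ hR
  rw [← initialRate_mul_rpow hν hM hμ hR hε]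
  refine mul_le_mul_of_nonneg_left ?_ hT.le
  rw [← Real.rpow_natCast, ← Real.rpow_mul (by norm_num), mul_comm, Real.rpow_mul (by norm_num),
    Real.rpow_natCast]
  refine Real.rpow_le_rpow (by positivity) ?_ (div_nonneg (by linarith) (by positivity))
  exact (pow_le_pow_right₀ (by norm_num) hj).trans (two_pow_numRestarts_le hε h)

/-- The sum of the rates over the restarts. For `ν < 1` the last restart dominates; for `ν = 1`
all restarts have the same length. -/
theorem sum_rate_le (hν : 0 ≤ ν) (hν' : ν ≤ 1) (hM : 0 < M) (hμ : 0 < μ) (hR : 0 < R₀)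
    (hε : 0 < ε) (h : 2 * ε < μ * R₀ ^ 2) :
    ∑ j ∈ Finset.range (numRestarts μ R₀ ε),
      initialRate ν M μ R₀ * ((2 : ℝ) ^ ((1 - ν) / (1 + 3 * ν))) ^ j ≤
        rateConst ν * complexity ν M μ R₀ ε := by
  have hT := initialRate_pos (ν := ν) hM hμ hR
  have hT2 := finalRate_pos (ν := ν) hM hμ hε
  have hc := two_le_rateConst hν hν'
  have hfin := initialRate_mul_pow_le hν hν' hM hμ hR hε h le_rfl
  rcases hν'.eq_or_lt with h1 | h1
  · have h2 : (1 - ν) / (1 + 3 * ν) = 0 := by rw [h1]; norm_num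
    simp only [h2, Real.rpow_zero, one_pow, mul_one, Finset.sum_const, Finset.card_range,
      nsmul_eq_mul]
    have h3 := one_half_le_log hε h
    calc (numRestarts μ R₀ ε : ℝ) * initialRate ν M μ R₀
        ≤ 2 * Real.log (μ * R₀ ^ 2 / ε) * initialRate ν M μ R₀ := by
          gcongr; exact numRestarts_le hε h
      _ = 2 * (initialRate ν M μ R₀ * Real.log (μ * R₀ ^ 2 / ε)) := by ring
      _ ≤ rateConst ν * complexity ν M μ R₀ ε := by
          rw [complexity_eq]
          gcongr
          exact le_max_left _ _
  · have hρ : (1 : ℝ) < 2 ^ ((1 - ν) / (1 + 3 * ν)) :=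
      Real.one_lt_rpow (by norm_num) (div_pos (by linarith) (by positivity))
    unfold rateConst at hc ⊢
    set ρ : ℝ := 2 ^ ((1 - ν) / (1 + 3 * ν))
    have hρ1 : 0 < ρ - 1 := by linarith
    rw [← Finset.mul_sum, geom_sum_eq hρ.ne']
    calc initialRate ν M μ R₀ * ((ρ ^ numRestarts μ R₀ ε - 1) / (ρ - 1))
        ≤ initialRate ν M μ R₀ * ((ρ ^ numRestarts μ R₀ ε * ρ) / (ρ - 1)) := by
          gcongr
          have : 0 < ρ ^ numRestarts μ R₀ ε := by positivity
          nlinarith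
      _ = (ρ / (ρ - 1)) * (initialRate ν M μ R₀ * ρ ^ numRestarts μ R₀ ε) := by ring
      _ ≤ (2 + ρ / (ρ - 1)) * complexity ν M μ R₀ ε := by
          refine mul_le_mul (by linarith) ?_ (by positivity) (by positivity)
          exact hfin.trans (le_max_right _ _)

/-- The logarithm `L_t`, which depends on `N_t` and so on itself, is of the order of the
logarithmic factor in the complexity. -/
theorem Admissible.logNt_le (hadm : Admissible ν M μ R₀ β (numRestarts μ R₀ ε) N)
    (hν : 0 ≤ ν) (hν' : ν ≤ 1) (hM : 0 < M) (hμ : 0 < μ) (hR : 0 < R₀)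
    (hε : 0 < ε) (hβ : 0 < β) (h : 2 * ε < μ * R₀ ^ 2) (hj : j < numRestarts μ R₀ ε) :
    logNt β (numRestarts μ R₀ ε) N (j + 1) ≤ 42 * max 1 (logFactor ν M μ R₀ ε β) := by
  have hL := hadm.two_le_log (j + 1) (succ_mem_Icc hj)
  have hNs := hadm.N_succ hν hR hj
  have hX := hadm.le_iterationBound hν hM hμ hR hj
  have hLdef : logNt β (numRestarts μ R₀ ε) N (j + 1) =
    Real.log (4 * N (j + 1) * numRestarts μ R₀ ε / β) := rfl
  set L := logNt β (numRestarts μ R₀ ε) N (j + 1)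
  have hL0 : 0 < L := by linarith
  have hXle := iterationBound_le hν hM hμ hR hL0 j
  set X := iterationBound ν M μ R₀ L j
  have hT := finalRate_pos (ν := ν) hM hμ hε
  have hτ : (0 : ℝ) < numRestarts μ R₀ ε := by exact_mod_cast numRestarts_pos hε h
  have hlog := one_half_le_log hε h
  have hN : (N (j + 1) : ℝ) ≤ 2 * X := by
    rw [hNs]; push_cast
    linarith [Nat.ceil_lt_add_one (by linarith : 0 ≤ X)]
  have hN0 : (0 : ℝ) < N (j + 1) := by rw [hNs]; positivity
  have hLpow : L ^ (2 * (1 + ν) / (1 + 3 * ν)) ≤ L ^ 2 := by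
    rw [← Real.rpow_two]
    refine Real.rpow_le_rpow_of_exponent_le (by linarith) ?_
    rw [div_le_iff₀ (by positivity)]; linarith
  have hX2 : X ≤ 3670016 * finalRate ν M μ ε * L ^ 2 :=
    hXle.trans (by
      gcongr
      exact initialRate_mul_pow_le hν hν' hM hμ hR hε h hj.le)
  have harg : 4 * N (j + 1) * numRestarts μ R₀ ε / β ≤
      2 ^ 26 * L ^ 2 * (finalRate ν M μ ε * Real.log (μ * R₀ ^ 2 / ε) / β) := by
    calc _ ≤ 4 * (2 * (3670016 * finalRate ν M μ ε * L ^ 2)) *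
          (2 * Real.log (μ * R₀ ^ 2 / ε)) / β := by
          gcongr
          · linarith
          · exact numRestarts_le hε h
      _ = 58720256 * (L ^ 2 * (finalRate ν M μ ε * Real.log (μ * R₀ ^ 2 / ε) / β)) := by ring
      _ ≤ 2 ^ 26 * (L ^ 2 * (finalRate ν M μ ε * Real.log (μ * R₀ ^ 2 / ε) / β)) := by
          gcongr; norm_num
      _ = _ := by ring
  have hle := Real.log_le_log (by positivity) harg
  rw [← hLdef, Real.log_mul (by positivity) (by positivity), Real.log_mul (by norm_num)
    (by positivity), ← logFactor_eq hM hμ hε, Real.log_pow, Real.log_pow] at hle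
  push_cast at hle
  -- the logarithm of `L` is absorbed by `L` itself
  have hlogL : Real.log L ≤ L / 4 - 1 + 2 * Real.log 2 := by
    have h1 := Real.log_le_sub_one_of_pos (by positivity : 0 < L / 4)
    rw [Real.log_div hL0.ne' (by norm_num), show (4 : ℝ) = 2 ^ 2 by norm_num, Real.log_pow] at h1
    push_cast at h1
    linarith
  have hlog2 := Real.log_two_lt_d9
  have hm1 := le_max_left 1 (logFactor ν M μ R₀ ε β)
  have hm2 := le_max_right 1 (logFactor ν M μ R₀ ε β)
  linarith

theorem Admissible.sum_iterations_le (hadm : Admissible ν M μ R₀ β (numRestarts μ R₀ ε) N)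
    (hν : 0 ≤ ν) (hν' : ν ≤ 1) (hM : 0 < M) (hμ : 0 < μ) (hR : 0 < R₀)
    (hε : 0 < ε) (hβ : 0 < β) (h : 2 * ε < μ * R₀ ^ 2) :
    ∑ j ∈ Finset.range (numRestarts μ R₀ ε), (N (j + 1) : ℝ) ≤
      (2 * 3670016 * 1764 * rateConst ν) * (complexity ν M μ R₀ ε *
        max 1 (logFactor ν M μ R₀ ε β) ^ (2 * (1 + ν) / (1 + 3 * ν))) := by
  have hT := initialRate_pos (ν := ν) hM hμ hR
  set Λ := max 1 (logFactor ν M μ R₀ ε β) with hΛ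
  have hΛ0 : 0 < Λ := zero_lt_one.trans_le (le_max_left _ _)
  set e := 2 * (1 + ν) / (1 + 3 * ν) with he
  have he2 : e ≤ 2 := by rw [he, div_le_iff₀ (by positivity)]; linarith
  have he0 : 0 ≤ e := by positivity
  have hterm (j : ℕ) (hj : j ∈ Finset.range (numRestarts μ R₀ ε)) : (N (j + 1) : ℝ) ≤
      (2 * 3670016 * 1764 * Λ ^ e) *
        (initialRate ν M μ R₀ * ((2 : ℝ) ^ ((1 - ν) / (1 + 3 * ν))) ^ j) := by
    have hj' := Finset.mem_range.1 hj
    have hL := hadm.two_le_log (j + 1) (succ_mem_Icc hj')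
    have hNs := hadm.N_succ hν hR hj'
    have hX := hadm.le_iterationBound hν hM hμ hR hj'
    have hLΛ := hadm.logNt_le hν hν' hM hμ hR hε hβ h hj'
    rw [← hΛ] at hLΛ
    set L := logNt β (numRestarts μ R₀ ε) N (j + 1)
    have hL0 : 0 < L := by linarith
    have hXle := iterationBound_le hν hM hμ hR hL0 j
    set X := iterationBound ν M μ R₀ L j
    have hN : (N (j + 1) : ℝ) ≤ 2 * X := by
      rw [hNs]; push_cast
      linarith [Nat.ceil_lt_add_one (by linarith : 0 ≤ X)]
    have hLe : L ^ e ≤ 1764 * Λ ^ e := by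
      calc L ^ e ≤ (42 * Λ) ^ e := by gcongr
        _ = 42 ^ e * Λ ^ e := Real.mul_rpow (by norm_num) hΛ0.le
        _ ≤ 42 ^ (2 : ℝ) * Λ ^ e := by
            gcongr
            norm_num
        _ = 1764 * Λ ^ e := by rw [Real.rpow_two]; norm_num
    calc (N (j + 1) : ℝ) ≤ 2 * (3670016 *
          (initialRate ν M μ R₀ * ((2 : ℝ) ^ ((1 - ν) / (1 + 3 * ν))) ^ j) * L ^ e) := by
          linarith
      _ ≤ 2 * (3670016 * (initialRate ν M μ R₀ * ((2 : ℝ) ^ ((1 - ν) / (1 + 3 * ν))) ^ j) *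
          (1764 * Λ ^ e)) := by gcongr
      _ = _ := by ring
  refine (Finset.sum_le_sum hterm).trans ?_
  rw [← Finset.mul_sum]
  calc _ ≤ (2 * 3670016 * 1764 * Λ ^ e) * (rateConst ν * complexity ν M μ R₀ ε) := by
        gcongr
        exact sum_rate_le hν hν' hM hμ hR hε h
    _ = _ := by ring

/-! ### The number of oracle calls -/

/-- The oracle calls of one restart: two calls per iteration account for rounding, and the rest is
governed by `(N α_N)² ≤ (2 A_N)²`, which is of the order of `(R² / ε)²`. -/
theorem sum_batchSize_le (hν : 0 ≤ ν) (hR : 0 < R₀) (hμ : 0 < μ)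
    (hp : RunBounds ν M (radius R₀ j) (accuracy μ R₀ (j + 1)) (logNt β τ N (j + 1))
      (paramAlpha ν M μ R₀ β τ N (j + 1)) (N (j + 1))) :
    ∑ k ∈ Finset.range (N (j + 1)), (batchSize ν M μ R₀ σ β τ N (j + 1) k : ℝ) ≤
      2 * N (j + 1) +
        2600000 * (σ ^ 2 * logNt β τ N (j + 1) / (μ * accuracy μ R₀ (j + 1))) := by
  have hα := hp.alpha_pos
  have hL0 : 0 < logNt β τ N (j + 1) := by linarith [hp.two_le]
  have hr := hp.R_pos
  have hε := hp.eps_pos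
  have hεr := accuracy_succ μ R₀ j
  obtain ⟨K, hK⟩ : ∃ K, N (j + 1) = K + 1 := ⟨N (j + 1) - 1, by have := hp.N_pos; omega⟩
  have hupp := hp.upper
  have hgr := hp.growth K
  have hNK : ((K : ℝ) + 1) = N (j + 1) := by rw [hK]; push_cast; rfl
  have hb (k : ℕ) := batchSize_succ (ν := ν) (M := M) (μ := μ) (σ := σ) (β := β) (τ := τ) (N := N)
    (j := j) hR k
  set r := radius R₀ j
  set ε := accuracy μ R₀ (j + 1)
  set L := logNt β τ N (j + 1)
  set α := paramAlpha ν M μ R₀ β τ N (j + 1)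
  have hs := stepSize_pos (ν := ν) hα K
  set s := stepSize α ν (K + 1)
  have hN0 : (0 : ℝ) < N (j + 1) := by exact_mod_cast hp.N_pos
  rw [hNK, ← hK] at hgr
  -- the last stepsize is the largest one
  have hterm (k : ℕ) (hk : k ∈ Finset.range (N (j + 1))) :
      (batchSize ν M μ R₀ σ β τ N (j + 1) k : ℝ) ≤
        2 + 20736 * N (j + 1) * σ ^ 2 * s ^ 2 * L / (constC * r) ^ 2 := by
    have hkK : k ≤ K := by rw [Finset.mem_range] at hk; omega
    have hsk := stepSize_mono hν hα hkK
    have hsk0 := stepSize_pos (ν := ν) hα k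
    rw [hb]
    set Y := 20736 * N (j + 1) * σ ^ 2 * stepSize α ν (k + 1) ^ 2 * L / (constC * r) ^ 2 with hY
    have hY0 : 0 ≤ Y := by positivity
    have h1 := Nat.ceil_lt_add_one (zero_le_one.trans (le_max_left 1 Y))
    have h2 : max 1 Y ≤ 1 + Y := max_le (by linarith) (by linarith)
    have h3 : Y ≤ 20736 * N (j + 1) * σ ^ 2 * s ^ 2 * L / (constC * r) ^ 2 := by
      rw [hY]; gcongr
    linarith
  refine (Finset.sum_le_sum hterm).trans ?_
  rw [Finset.sum_const, Finset.card_range, nsmul_eq_mul]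
  have hNs : N (j + 1) * s * ε ≤ 146 / 10 * r ^ 2 := by
    calc N (j + 1) * s * ε ≤ 2 * stepSum α ν (N (j + 1)) * ε := by gcongr
      _ ≤ 146 / 10 * r ^ 2 := by linarith
  have hNs2 : (N (j + 1) * s * ε) ^ 2 ≤ (146 / 10 * r ^ 2) ^ 2 := by gcongr
  have hmain : N (j + 1) * (20736 * N (j + 1) * σ ^ 2 * s ^ 2 * L / (constC * r) ^ 2) ≤
      2600000 * (σ ^ 2 * L / (μ * ε)) := by
    have e1 : N (j + 1) * (20736 * N (j + 1) * σ ^ 2 * s ^ 2 * L / (constC * r) ^ 2) =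
        20736 / 7 * (σ ^ 2 * L) * ((N (j + 1) * s * ε) ^ 2 / (r ^ 2 * ε ^ 2)) := by
      rw [mul_pow constC, constC_sq]; field_simp
    have e2 : (146 / 10 * r ^ 2) ^ 2 / (r ^ 2 * ε ^ 2) = (146 / 10) ^ 2 * 4 / (μ * ε) := by
      rw [hεr]; field_simp
    rw [e1]
    calc _ ≤ 20736 / 7 * (σ ^ 2 * L) * ((146 / 10 * r ^ 2) ^ 2 / (r ^ 2 * ε ^ 2)) := by gcongr
      _ = (20736 / 7 * (146 / 10) ^ 2 * 4) * (σ ^ 2 * L / (μ * ε)) := by rw [e2]; ring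
      _ ≤ 2600000 * (σ ^ 2 * L / (μ * ε)) :=
          mul_le_mul_of_nonneg_right (by norm_num) (by positivity)
  linarith

theorem sum_inv_accuracy_le (hμ : 0 < μ) (hR : 0 < R₀) (hε : 0 < ε) (h : 2 * ε < μ * R₀ ^ 2) :
    ∑ j ∈ Finset.range (numRestarts μ R₀ ε), (accuracy μ R₀ (j + 1))⁻¹ ≤ 4 / ε := by
  have h1 : ∀ t : ℕ, ∑ j ∈ Finset.range t, (accuracy μ R₀ (j + 1))⁻¹ ≤
      4 * 2 ^ t / (μ * R₀ ^ 2) := by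
    intro t
    induction t with
    | zero => simp; positivity
    | succ t ih =>
      rw [Finset.sum_range_succ]
      refine (add_le_add_left ih _).trans (le_of_eq ?_)
      rw [accuracy]
      field_simp
      ring
  refine (h1 _).trans ?_
  have h2 := two_pow_numRestarts_le hε h
  rw [le_div_iff₀ hε] at h2
  rw [div_le_div_iff₀ (by positivity) hε]
  linarith

theorem Admissible.sum_oracleCalls_le (hadm : Admissible ν M μ R₀ β (numRestarts μ R₀ ε) N)
    (hν : 0 ≤ ν) (hν' : ν ≤ 1) (hM : 0 < M) (hμ : 0 < μ) (hR : 0 < R₀)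
    (hε : 0 < ε) (hβ : 0 < β) (h : 2 * ε < μ * R₀ ^ 2)
    (hμM : ∀ j, μ * radius R₀ j ^ (1 - ν) ≤ M) :
    ∑ j ∈ Finset.range (numRestarts μ R₀ ε), ∑ k ∈ Finset.range (N (j + 1)),
        (batchSize ν M μ R₀ σ β (numRestarts μ R₀ ε) N (j + 1) k : ℝ) ≤
      2 * ∑ j ∈ Finset.range (numRestarts μ R₀ ε), (N (j + 1) : ℝ) +
        436800000 * (σ ^ 2 / (μ * ε) * max 1 (logFactor ν M μ R₀ ε β)) := by
  set Λ := max 1 (logFactor ν M μ R₀ ε β) with hΛ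
  have hΛ0 : 0 < Λ := zero_lt_one.trans_le (le_max_left _ _)
  have hterm (j : ℕ) (hj : j ∈ Finset.range (numRestarts μ R₀ ε)) :
      ∑ k ∈ Finset.range (N (j + 1)),
        (batchSize ν M μ R₀ σ β (numRestarts μ R₀ ε) N (j + 1) k : ℝ) ≤
      2 * N (j + 1) + 2600000 * 42 * (σ ^ 2 * Λ / μ) * (accuracy μ R₀ (j + 1))⁻¹ := by
    have hj' := Finset.mem_range.1 hj
    have hLΛ := hadm.logNt_le hν hν' hM hμ hR hε hβ h hj'
    have hacc := accuracy_pos hμ hR (j + 1)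
    refine (sum_batchSize_le hν hR hμ
      (hadm.runBounds hν hν' hM hμ hR hj' (hμM j))).trans (add_le_add_right ?_ _)
    calc _ ≤ 2600000 * (σ ^ 2 * (42 * Λ) / (μ * accuracy μ R₀ (j + 1))) := by gcongr
      _ = _ := by field_simp
  refine (Finset.sum_le_sum hterm).trans ?_
  rw [Finset.sum_add_distrib, ← Finset.mul_sum, ← Finset.mul_sum]
  refine add_le_add_right ?_ _
  calc _ ≤ 2600000 * 42 * (σ ^ 2 * Λ / μ) * (4 / ε) := by
        gcongr
        exact sum_inv_accuracy_le hμ hR hε h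
    _ = _ := by field_simp; ring

end Rates

end ClippedSSTM

theorem mainTheorem3 (ν : ℝ) (hν₀ : 0 ≤ ν) (hν₁ : ν ≤ 1) :
    ∃ c : ℝ, 0 < c ∧
      ∀ (n : ℕ), 0 < n →
      ∀ (f : EuclideanSpace ℝ (Fin n) → ℝ) (x0 xstar : EuclideanSpace ℝ (Fin n))
        (M μ R₀ σ ε β : ℝ),
        0 < M → 0 < μ → 0 < σ → 0 < ε → 0 < β → β < 1 →
        ClippedSSTM.IsStronglyConvex f μ →
        (∀ x, f xstar ≤ f x) →
        ‖x0 - xstar‖ ≤ R₀ →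
        ClippedSSTM.HasHolderGradientOn f ν M (Metric.closedBall xstar (3 * R₀)) →
        2 * ε < μ * R₀ ^ 2 →
      ∀ (Ξ : Type*) [MeasurableSpace Ξ] (D : Measure Ξ) [IsProbabilityMeasure D]
        (G : EuclideanSpace ℝ (Fin n) → Ξ → EuclideanSpace ℝ (Fin n)),
        ClippedSSTM.IsStochasticGradient f G D σ →
      ∀ (Ω : Type*) [MeasurableSpace Ω] (P : Measure Ω) [IsProbabilityMeasure P]
        (ξ : ℕ × ℕ × ℕ → Ω → Ξ),
        (∀ j, Measurable (ξ j)) → (∀ j, P.map (ξ j) = D) → iIndepFun ξ P →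
      ∀ (N : ℕ → ℕ),
        ClippedSSTM.Admissible ν M μ R₀ β (ClippedSSTM.numRestarts μ R₀ ε) N →
        ENNReal.ofReal (1 - β) ≤
            P {ω | f (ClippedSSTM.output G ξ x0 ν M μ R₀ σ ε β N ω).point - f xstar ≤ ε} ∧
          ∀ ω : Ω,
            ((ClippedSSTM.output G ξ x0 ν M μ R₀ σ ε β N ω).iterations : ℝ) ≤
                c * (ClippedSSTM.complexity ν M μ R₀ ε *
                  max 1 (ClippedSSTM.logFactor ν M μ R₀ ε β) ^
                    (2 * (1 + ν) / (1 + 3 * ν))) ∧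
            ((ClippedSSTM.output G ξ x0 ν M μ R₀ σ ε β N ω).oracleCalls : ℝ) ≤
                c * max ((ClippedSSTM.output G ξ x0 ν M μ R₀ σ ε β N ω).iterations : ℝ)
                  (σ ^ 2 / (μ * ε) * max 1 (ClippedSSTM.logFactor ν M μ R₀ ε β)) := by
  open ClippedSSTM in
  have hrc := two_le_rateConst hν₀ hν₁
  -- the sum of the constants in the bounds for the iterations and for the oracle calls
  refine ⟨2 * 3670016 * 1764 * rateConst ν + 436800002, by positivity, ?_⟩
  intro n hn f x0 xs M μ R₀ σ ε β hM hμ _ hε hβ _ hf hmin hx0 hQ hεR Ξ _ D _ G hG Ω _ P _ ξ hξ hD hi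
    N hadm
  have hR : 0 < R₀ := by
    refine lt_of_le_of_ne ((norm_nonneg _).trans hx0) fun h => ?_
    rw [← h] at hεR
    simp at hεR
    linarith
  have hτ := numRestarts_pos hε hεR
  have hτ' : (0 : ℝ) < numRestarts μ R₀ ε := by exact_mod_cast hτ
  have hμM (j : ℕ) : μ * radius R₀ j ^ (1 - ν) ≤ M := by
    refine hf.mul_rpow_le hmin hn (radius_pos hR j) fun x hx y hy => hQ x ?_ y ?_
    · exact Metric.closedBall_subset_closedBall (by linarith [radius_le hR j]) hx
    · exact Metric.closedBall_subset_closedBall (by linarith [radius_le hR j]) hy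
  refine ⟨?_, fun ω => ⟨?_, ?_⟩⟩
  · have hbad := measure_restartedRun_le hν₀ hν₁ hn hM hμ hR hβ hf hmin hx0 hQ hG hξ hD hi hadm
      le_rfl rfl
    rw [mul_div_cancel₀ _ hτ'.ne'] at hbad
    have hacc := accuracy_numRestarts_le hε hεR
    set good : Set Ω := {ω | f (output G ξ x0 ν M μ R₀ σ ε β N ω).point - f xs ≤ ε}
    have hle : P goodᶜ ≤ ENNReal.ofReal β := by
      refine (measure_mono ?_).trans hbad
      intro ω hω hω'
      exact hω ((hω'.2 hτ).trans hacc)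
    have hone : 1 ≤ P good + ENNReal.ofReal β := by
      calc (1 : ENNReal) = P (good ∪ goodᶜ) := by rw [Set.union_compl_self, measure_univ]
        _ ≤ P good + P goodᶜ := measure_union_le _ _
        _ ≤ _ := by gcongr
    rw [ENNReal.ofReal_sub _ hβ.le, ENNReal.ofReal_one]
    exact tsub_le_iff_right.2 hone
  · rw [output, restartedRun_iterations]
    push_cast
    refine (hadm.sum_iterations_le hν₀ hν₁ hM hμ hR hε hβ hεR).trans ?_
    refine mul_le_mul_of_nonneg_right (by linarith) (mul_nonneg ?_ (by positivity))
    exact (finalRate_pos hM hμ hε).le.trans (le_max_right _ _)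
  · rw [output, restartedRun_oracleCalls, restartedRun_iterations]
    push_cast
    refine (hadm.sum_oracleCalls_le hν₀ hν₁ hM hμ hR hε hβ hεR hμM).trans ?_
    set I := ∑ j ∈ Finset.range (numRestarts μ R₀ ε), (N (j + 1) : ℝ)
    set J := σ ^ 2 / (μ * ε) * max 1 (logFactor ν M μ R₀ ε β)
    have h1 := le_max_left I J
    have h2 := le_max_right I J
    have h3 : 0 ≤ max I J := le_trans (Finset.sum_nonneg fun _ _ => Nat.cast_nonneg _) h1
    have h4 : 436800002 * max I J ≤ (2 * 3670016 * 1764 * rateConst ν + 436800002) * max I J :=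
      mul_le_mul_of_nonneg_right (by linarith) h3
    linarith
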